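/- **Setting.** All systems are qubits, $\mathcal H=\mathbb C^2$. A quantum channel is a completely positive trace preserving linear map. A bipartite channel $\Phi$ on $B(\mathcal H_A\otimes\mathcal H_B)$ (input and output spaces $\mathcal H_{\mathrm{in}}=\mathcal H_{\mathrm{out}}=\mathcal H\otimes\mathcal H$) is *non-signaling* if $\mathrm{Tr}_A\Phi(X)$ depends only on $\mathrm{Tr}_A X$ and $\mathrm{Tr}_B\Phi(X)$ depends only on $\mathrm{Tr}_B X$. A *two-outcome measurement on qubit channels* consists of a state $\rho$ on $\mathcal H\otimes\mathcal H'$ ($\mathcal H'$ any finite-dimensional ancilla) and an effect $0\le E\le \mathbb 1$ on $\mathcal H\otimes\mathcal H'$: one applies the channel to the $\mathcal H$-part of $\rho$ and then measures $E_{1}=E$, $E_{-1}=\mathbb 1-E$. If Alice performs such a measurement $\mathsf C=(\rho_{\mathsf C},E^{\mathsf C})$ and Bob $\mathsf D=(\rho_{\mathsf D},E^{\mathsf D})$ on their parts of $\Phi$, the outcomes $\epsilon,\eta\in\{1,-1\}$ have probability $P(\epsilon,\eta|\mathsf C,\mathsf D)=\mathrm{Tr}\big[(\Phi\otimes \mathrm{id})(\rho_{\mathsf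 C}\otimes\rho_{\mathsf D})\,(E^{\mathsf C}_\epsilon\otimes E^{\mathsf D}_\eta)\big]$, and $E(\mathsf C,\mathsf D)=\sum_{\epsilon,\eta}\epsilon\eta\,P(\epsilon,\eta|\mathsf C,\mathsf D)$. A *qubit PR-channel* is a non-signaling $\Phi$ for which there are channel measurements $\mathsf A,\mathsf A'$ (Alice) and $\mathsf B,\mathsf B'$ (Bob) with maximal CHSH violation $$\big|E(\mathsf A,\mathsf B)+E(\mathsf A,\mathsf B')+E(\mathsf A',\mathsf B)-E(\mathsf A',\mathsf B')\big|=4 .$$ For $x,y,z\in\mathbb C$ put $B_{\mathrm{diag}}(z)=\begin{pmatrix}1&z\\ \bar z&1\end{pmatrix}$ and $B_{\mathrm{off}}(x,y)=\begin{pmatrix}0&x\\ y&0\end{pmatrix}$; for $r\in\mathbb N$, $B_r$ denotes a matrix in $B(\mathbb C^2\otimes\mathbb C^r)$ of the form $$B_r=\tfrac12\Big(\sum_{p=1}^r B_{\mathrm{diag}}(z_p)\otimes|p\rangle\langle p|+\sum_{p\ne q}B_{\mathrm{off}}(x_{p,q},y_{p,q})\otimes|p\rangle\langle q|\Big),\qquad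 z_p,x_{p,q},y_{p,q}\in\mathbb C .$$ **Proposition.** Let $\Phi$ be a qubit PR-channel and let $\mathsf A,\mathsf A',\mathsf B,\mathsf B'$ be measurements realizing the maximal violation. Then there are orthonormal bases $a_0,a_1$ and $b_0,b_1$ of $\mathbb C^2$ such that the reduced input states (on $\mathcal H$) of $\mathsf A,\mathsf A',\mathsf B,\mathsf B'$ are $|a_0\rangle\langle a_0|$, $|a_1\rangle\langle a_1|$, $|b_0\rangle\langle b_0|$, $|b_1\rangle\langle b_1|$, respectively, and such that the following holds for the input basis $|\alpha\rangle=a_k\otimes b_m$, $\alpha=km\in\{0,1\}^2$, and the Choi matrix $C=\sum_{\alpha,\beta}\Phi(|\alpha\rangle\langle\beta|)\otimes|\alpha\rangle\langle\beta|\in B(\mathcal H_{\mathrm{out}}\otimes\mathcal H_{\mathrm{in}})$ with respect to it. There are isometries $U_\alpha:\mathbb C^2\to\mathcal H_{\mathrm{out}}$, $\alpha\in\{0,1\}^2$, a partition $\{0,1\}^2=\Delta_0\cup\Delta_1$ into disjoint sets, an isometry $V_{\mathrm{out}}:\mathbb C^2\to\mathcal H_{\mathrm{out}}$ with $U_\alpha=V_{\mathrm{out}}$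 for all $\alpha\in\Delta_1$, an enumeration $\Delta_1=\{\alpha_1,\dots,\alpha_r\}$, $r=|\Delta_1|$, with the isometry $V_{\mathrm{in}}:\mathbb C^r\to\mathcal H_{\mathrm{in}}$, $V_{\mathrm{in}}|p\rangle=|\alpha_p\rangle$, a matrix $B_r$ of the above form, and numbers $z_\alpha\in\mathbb C$ with $|z_\alpha|\le1$, $\alpha\in\Delta_0$, such that $$C=(V_{\mathrm{out}}\otimes V_{\mathrm{in}})\,B_r\,(V_{\mathrm{out}}^*\otimes V_{\mathrm{in}}^*)+\tfrac12\sum_{\alpha\in\Delta_0}U_\alpha B_{\mathrm{diag}}(z_\alpha)U_\alpha^*\otimes|\alpha\rangle\langle\alpha| .$$ -/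

import Mathlib

open scoped Kronecker Matrix ComplexOrder

/-- Operators on `ℂ² ⊗ ℂ²`, in the computational product basis `|ij⟩`, `i, j ∈ {0, 1}`;
the first factor is Alice's qubit, the second one is Bob's. -/
abbrev TwoQubitOp : Type := Matrix (Fin 2 × Fin 2) (Fin 2 × Fin 2) ℂ

/-! ### Channels -/

/-- `Φ ⊗ id` on operators on `ℂ^ι ⊗ ℂ^κ`. -/
def ampliation {ι κ : Type} (Φ : Matrix ι ι ℂ →ₗ[ℂ] Matrix ι ι ℂ)
    (X : Matrix (ι × κ) (ι × κ) ℂ) : Matrix (ι × κ) (ι × κ) ℂ :=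
  Matrix.of fun p q => Φ (Matrix.of fun i j => X (i, p.2) (j, q.2)) p.1 q.1

/-- Complete positivity: `Φ ⊗ id_d` preserves positive semidefiniteness for every `d`. -/
def IsCompletelyPositive {ι : Type} (Φ : Matrix ι ι ℂ →ₗ[ℂ] Matrix ι ι ℂ) : Prop :=
  ∀ (d : ℕ) (X : Matrix (ι × Fin d) (ι × Fin d) ℂ),
    X.PosSemidef → (ampliation Φ X).PosSemidef

/-- Quantum channels: completely positive trace preserving maps. -/
structure IsQuantumChannel {ι : Type} [Fintype ι]
    (Φ : Matrix ι ι ℂ →ₗ[ℂ] Matrix ι ι ℂ) : Prop where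
  completelyPositive : IsCompletelyPositive Φ
  tracePreserving : ∀ X, (Φ X).trace = X.trace

/-- Partial trace over the first tensor factor. -/
def trFst {m n : Type} [Fintype m] (X : Matrix (m × n) (m × n) ℂ) : Matrix n n ℂ :=
  Matrix.of fun j j' => ∑ i, X (i, j) (i, j')

/-- Partial trace over the second tensor factor. -/
def trSnd {m n : Type} [Fintype n] (X : Matrix (m × n) (m × n) ℂ) : Matrix m m ℂ :=
  Matrix.of fun i i' => ∑ j, X (i, j) (i', j)

/-- Non-signaling (causal) bipartite channels: Bob's marginal of the output depends only on Bob's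
marginal of the input, and likewise for Alice. -/
structure IsNonSignalingChannel (Φ : TwoQubitOp →ₗ[ℂ] TwoQubitOp) : Prop where
  isChannel : IsQuantumChannel Φ
  noSignalAB : ∀ X Y, trFst X = trFst Y → trFst (Φ X) = trFst (Φ Y)
  noSignalBA : ∀ X Y, trSnd X = trSnd Y → trSnd (Φ X) = trSnd (Φ Y)

/-! ### Two-outcome measurements on qubit channels and the CHSH quantity -/

/-- A two-outcome measurement (outcomes `1` and `-1`) on qubit channels: a state `input` of the
qubit and of a finite dimensional ancilla is prepared, the channel is applied to the qubit, and
the two-outcome measurement given by the quantum effect `eff` (for outcome `1`) is performed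
jointly on the output and on the ancilla. -/
structure ChannelMeasurement where
  anc : ℕ
  input : Matrix (Fin 2 × Fin anc) (Fin 2 × Fin anc) ℂ
  input_pos : input.PosSemidef
  input_trace : input.trace = 1
  eff : Matrix (Fin 2 × Fin anc) (Fin 2 × Fin anc) ℂ
  eff_pos : eff.PosSemidef
  eff_le_one : (1 - eff).PosSemidef

/-- The effect of the outcome `ε ∈ {1, -1}`. -/
def ChannelMeasurement.outcome (M : ChannelMeasurement) (ε : ℤˣ) :
    Matrix (Fin 2 × Fin M.anc) (Fin 2 × Fin M.anc) ℂ :=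
  if ε = 1 then M.eff else 1 - M.eff

/-- The operator `X ⊗ Y` on (Alice's qubit, her ancilla, Bob's qubit, his ancilla), rearranged to
the order (Alice's qubit, Bob's qubit), (Alice's ancilla, Bob's ancilla). -/
def regroup {s t : ℕ} (X : Matrix (Fin 2 × Fin s) (Fin 2 × Fin s) ℂ)
    (Y : Matrix (Fin 2 × Fin t) (Fin 2 × Fin t) ℂ) :
    Matrix ((Fin 2 × Fin 2) × (Fin s × Fin t)) ((Fin 2 × Fin 2) × (Fin s × Fin t)) ℂ :=
  (X ⊗ₖ Y).submatrix (Equiv.prodProdProdComm _ _ _ _) (Equiv.prodProdProdComm _ _ _ _)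

/-- The probability `P_Φ(ε, η | C, D) = Tr ((Φ ⊗ id)(ρ_C ⊗ ρ_D) (E_ε ⊗ E_η))` of the outcomes
`ε`, `η` when Alice performs `C` and Bob performs `D` on their parts of `Φ`. -/
noncomputable def outcomeProb (Φ : TwoQubitOp →ₗ[ℂ] TwoQubitOp) (C D : ChannelMeasurement)
    (ε η : ℤˣ) : ℝ :=
  (ampliation Φ (regroup C.input D.input) * regroup (C.outcome ε) (D.outcome η)).trace.re

/-- The correlation `E(C, D)`. -/
noncomputable def correlation (Φ : TwoQubitOp →ₗ[ℂ] TwoQubitOp) (C D : ChannelMeasurement) : ℝ :=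
  outcomeProb Φ C D 1 1 - outcomeProb Φ C D 1 (-1)
    - outcomeProb Φ C D (-1) 1 + outcomeProb Φ C D (-1) (-1)

/-- The CHSH quantity. -/
noncomputable def chsh (Φ : TwoQubitOp →ₗ[ℂ] TwoQubitOp) (A A' B B' : ChannelMeasurement) : ℝ :=
  correlation Φ A B + correlation Φ A B' + correlation Φ A' B - correlation Φ A' B'

/-- `Φ` is a qubit PR-channel, as witnessed by the channel measurements `A, A'` (Alice) and
`B, B'` (Bob): it is non-signaling and violates the CHSH inequality up to the algebraic maximum. -/
structure IsPRChannelWith (Φ : TwoQubitOp →ₗ[ℂ] TwoQubitOp)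
    (A A' B B' : ChannelMeasurement) : Prop where
  nonSignaling : IsNonSignalingChannel Φ
  maxViolation : |chsh Φ A A' B B'| = 4

/-! ### Choi matrices and the building blocks of the normal form -/

/-- `|v⟩⟨w|`. -/
def ketbra {ι : Type} (v w : ι → ℂ) : Matrix ι ι ℂ := Matrix.vecMulVec v (star w)

/-- Orthonormal bases of the qubit space. -/
abbrev QubitBasis : Type := OrthonormalBasis (Fin 2) ℂ (EuclideanSpace ℂ (Fin 2))

/-- The product basis vector `|α⟩ = |a_k⟩ ⊗ |b_m⟩`, for `α = (k, m)`. -/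
noncomputable def prodKet (a b : QubitBasis) (α : Fin 2 × Fin 2) : Fin 2 × Fin 2 → ℂ :=
  fun i => a α.1 i.1 * b α.2 i.2

/-- The Choi matrix `∑_{α, β} Φ(|α⟩⟨β|) ⊗ |α⟩⟨β|` of `Φ`, an operator on `H_out ⊗ H_in`, formed
with the orthonormal product basis `|α⟩` of the input space. -/
noncomputable def choi (a b : QubitBasis) (Φ : TwoQubitOp →ₗ[ℂ] TwoQubitOp) :
    Matrix ((Fin 2 × Fin 2) × (Fin 2 × Fin 2)) ((Fin 2 × Fin 2) × (Fin 2 × Fin 2)) ℂ :=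
  ∑ α, ∑ β, Φ (ketbra (prodKet a b α) (prodKet a b β)) ⊗ₖ
    ketbra (prodKet a b α) (prodKet a b β)

/-- Isometries `ℂ^n → ℂ^m`, as matrices. -/
def IsIsometry {m n : Type} [Fintype m] [DecidableEq n] (V : Matrix m n ℂ) : Prop :=
  Vᴴ * V = 1

def Bdiag (z : ℂ) : Matrix (Fin 2) (Fin 2) ℂ := !![1, z; star z, 1]

def Boff (x y : ℂ) : Matrix (Fin 2) (Fin 2) ℂ := !![0, x; y, 0]

/-- The block matrix `B_r` on `ℂ² ⊗ ℂ^r` with parameters `z_p` and `x_{p,q}, y_{p,q}`, `p ≠ q`. -/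
noncomputable def Bblock (r : ℕ) (z : Fin r → ℂ) (x y : Fin r → Fin r → ℂ) :
    Matrix (Fin 2 × Fin r) (Fin 2 × Fin r) ℂ :=
  (1 / 2 : ℂ) • ((∑ p, Bdiag (z p) ⊗ₖ Matrix.single p p (1 : ℂ))
    + ∑ p, ∑ q with q ≠ p, Boff (x p q) (y p q) ⊗ₖ Matrix.single p q (1 : ℂ))

/-! The proof rests on one principle: an outcome of probability zero annihilates every Kraus
operator involved, hence also annihilates one side of the image of any operator `ρ * Z`
(`mul_ampl_eq_zero`, `ampl_mul_eq_zero`). By positivity and non-signaling, maximal violation forces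
the statistics of a PR box (`prBox_of_chsh`), in which half of all outcome pairs have probability
zero.

Inputs. Alice's channel with Bob's outcome ignored does not depend on Bob's setting. For each pair
of Alice's outcomes, one of Bob's settings is such that none of his outcomes is compatible with
both. So the channel annihilates `ρ 0 * Z * ρ 1`, and taking the trace shows that the reduced inputs
are orthogonal (`trSnd_mul_trSnd_eq_zero`). On a qubit they are therefore pure and form an
orthonormal basis. Purity decouples the ancillas, which are absorbed into the effects, and these
become rank-one projections (`exists_reduced_measurement`). Bob's half follows by exchanging the
parties.

Outputs. For the input `α` only two product vectors `f_i ⊗ g_{i + t α}` can occur, so `Φ(|α⟩⟨β|)` is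
a 2×2 matrix of coefficients (`IsPRData.apply_ketbra`). Comparing marginals of `Φ(|α⟩⟨β|)` for
different inputs, and using that the four values of `t` have odd sum, one finds that a nonzero
coefficient with `α ≠ β` is off-diagonal and requires `t α = t β` as well as coinciding output bases
wherever the inputs differ (`IsPRData.of_coeff_ne_zero`). `Δ₁` consists of the inputs taking part in
such a coherence. Two disjoint coherent pairs with different output vectors would exhaust all four
inputs and make the sum of `t` even, so all of `Δ₁` shares one output isometry
(`IsPRData.outVec_eq_of_mem`). -/

/-! ### Positive semidefinite matrices -/

section PosSemidef

variable {m n l : Type} [Fintype m] [Fintype n] [Fintype l]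

open scoped MatrixOrder in
theorem Matrix.PosSemidef.exists_eq_conjTranspose_mul {E : Matrix n n ℂ} (hE : E.PosSemidef) :
    ∃ Y : Matrix n n ℂ, E = Yᴴ * Y := by
  classical
  obtain ⟨Y, hY⟩ := CStarAlgebra.nonneg_iff_eq_star_mul_self.mp hE.nonneg
  exact ⟨Y, hY⟩

theorem Matrix.PosSemidef.trace_mul_nonneg {X E : Matrix n n ℂ} (hX : X.PosSemidef)
    (hE : E.PosSemidef) : 0 ≤ (X * E).trace := by
  obtain ⟨Y, rfl⟩ := hE.exists_eq_conjTranspose_mul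
  rw [← Matrix.mul_assoc, Matrix.trace_mul_comm, ← Matrix.mul_assoc]
  exact (hX.mul_mul_conjTranspose_same Y).trace_nonneg

/-- With `E = Yᴴ * Y` and `ρ = Rᴴ * R`, the trace is the squared Hilbert–Schmidt norm of `Y * N *
Rᴴ`. -/
theorem Matrix.PosSemidef.mul_mul_eq_zero {N : Matrix m n ℂ} {ρ : Matrix n n ℂ}
    {E : Matrix m m ℂ} (hρ : ρ.PosSemidef) (hE : E.PosSemidef)
    (h : (N * ρ * Nᴴ * E).trace = 0) : E * N * ρ = 0 := by
  obtain ⟨Y, rfl⟩ := hE.exists_eq_conjTranspose_mul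
  obtain ⟨R, rfl⟩ := hρ.exists_eq_conjTranspose_mul
  have h0 : Y * N * Rᴴ = 0 := by
    rw [← Matrix.trace_mul_conjTranspose_self_eq_zero_iff, ← h]
    rw [Matrix.trace_mul_comm, Matrix.trace_mul_comm _ (Yᴴ * Y)]
    simp only [Matrix.conjTranspose_mul, Matrix.conjTranspose_conjTranspose, Matrix.mul_assoc]
    rw [Matrix.trace_mul_comm]
    simp only [Matrix.mul_assoc]
    rw [Matrix.trace_mul_comm]
    simp only [Matrix.mul_assoc]
  have : Yᴴ * Y * N * (Rᴴ * R) = Yᴴ * (Y * N * Rᴴ) * R := by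
    simp only [Matrix.mul_assoc]
  rw [this, h0]; simp

theorem Matrix.PosSemidef.mul_eq_zero_of_trace {X E : Matrix n n ℂ}
    (hX : X.PosSemidef) (hE : E.PosSemidef) (h : (X * E).trace = 0) : E * X = 0 := by
  classical
  have := Matrix.PosSemidef.mul_mul_eq_zero (N := (1 : Matrix n n ℂ)) hX hE (by simpa using h)
  simpa using this

end PosSemidef

/-! ### Kraus form -/

section Kraus

variable {ι κ κ' : Type}

/-- The map has a Kraus decomposition. -/
def HasKraus [Fintype ι] (T : Matrix ι ι ℂ →ₗ[ℂ] Matrix ι ι ℂ) : Prop :=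
  ∃ (J : Type) (_ : Fintype J) (K : J → Matrix ι ι ℂ), ∀ X, T X = ∑ j, K j * X * (K j)ᴴ

/-- `T ⊗ id` on rectangular matrices. -/
def ampl (T : Matrix ι ι ℂ →ₗ[ℂ] Matrix ι ι ℂ)
    (X : Matrix (ι × κ) (ι × κ') ℂ) : Matrix (ι × κ) (ι × κ') ℂ :=
  Matrix.of fun p q => T (Matrix.of fun i j => X (i, p.2) (j, q.2)) p.1 q.1

variable [Fintype ι]

theorem ampl_kraus [Fintype κ] [Fintype κ'] [DecidableEq κ] [DecidableEq κ']
    {T : Matrix ι ι ℂ →ₗ[ℂ] Matrix ι ι ℂ} {J : Type} [Fintype J] {K : J → Matrix ι ι ℂ}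
    (hK : ∀ X, T X = ∑ j, K j * X * (K j)ᴴ) (X : Matrix (ι × κ) (ι × κ') ℂ) :
    ampl T X = ∑ j, (K j ⊗ₖ (1 : Matrix κ κ ℂ)) * X * (K j ⊗ₖ (1 : Matrix κ' κ' ℂ))ᴴ := by
  ext ⟨i, p⟩ ⟨i', p'⟩
  simp only [ampl, Matrix.of_apply, hK, Matrix.sum_apply, Matrix.mul_apply,
    Matrix.conjTranspose_apply, Fintype.sum_prod_type, Matrix.kroneckerMap_apply]
  refine Finset.sum_congr rfl fun j _ => ?_
  simp [Matrix.one_apply, apply_ite, ite_mul]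

theorem HasKraus.posSemidef {T : Matrix ι ι ℂ →ₗ[ℂ] Matrix ι ι ℂ} (hT : HasKraus T)
    {X : Matrix ι ι ℂ} (hX : X.PosSemidef) : (T X).PosSemidef := by
  obtain ⟨J, _, K, hK⟩ := hT
  rw [hK]
  exact Matrix.posSemidef_sum _ fun j _ => hX.mul_mul_conjTranspose_same _

theorem HasKraus.ampl_posSemidef [Fintype κ] {T : Matrix ι ι ℂ →ₗ[ℂ] Matrix ι ι ℂ}
    (hT : HasKraus T) {X : Matrix (ι × κ) (ι × κ) ℂ} (hX : X.PosSemidef) :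
    (ampl T X).PosSemidef := by
  classical
  obtain ⟨J, _, K, hK⟩ := hT
  rw [ampl_kraus hK]
  exact Matrix.posSemidef_sum _ fun j _ => hX.mul_mul_conjTranspose_same _

theorem mul_kraus_mul_eq_zero {m n J : Type} [Fintype m] [Fintype n] [Fintype J]
    (N : J → Matrix m n ℂ) {ρ : Matrix n n ℂ} {E : Matrix m m ℂ} (hρ : ρ.PosSemidef)
    (hE : E.PosSemidef) (h : ((∑ j, N j * ρ * (N j)ᴴ) * E).trace = 0) (j : J) :
    E * N j * ρ = 0 := by
  rw [Finset.sum_mul, Matrix.trace_sum, Finset.sum_eq_zero_iff_of_nonneg] at h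
  · exact hρ.mul_mul_eq_zero hE (h j (Finset.mem_univ j))
  · exact fun j _ => (hρ.mul_mul_conjTranspose_same _).trace_mul_nonneg hE

/-- A vanishing probability is a sum of nonnegative Kraus terms, so `E * (K j ⊗ₖ 1) * ρ = 0` for
each `j`, and the right factor is irrelevant. `Z` is rectangular so that measurements with ancillas
of different sizes can be compared. -/
theorem mul_ampl_eq_zero [Fintype κ] [Fintype κ'] {T : Matrix ι ι ℂ →ₗ[ℂ] Matrix ι ι ℂ}
    (hT : HasKraus T) {ρ E : Matrix (ι × κ) (ι × κ) ℂ} (hρ : ρ.PosSemidef) (hE : E.PosSemidef)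
    (h : (ampl T ρ * E).trace = 0) (Z : Matrix (ι × κ) (ι × κ') ℂ) :
    E * ampl T (ρ * Z) = 0 := by
  classical
  obtain ⟨J, _, K, hK⟩ := hT
  rw [ampl_kraus hK] at h ⊢
  rw [Matrix.mul_sum]
  refine Finset.sum_eq_zero fun j _ => ?_
  have := mul_kraus_mul_eq_zero _ hρ hE h j
  rw [← Matrix.mul_assoc, ← Matrix.mul_assoc, ← Matrix.mul_assoc, this]
  simp

theorem ampl_mul_eq_zero [Fintype κ] [Fintype κ'] {T : Matrix ι ι ℂ →ₗ[ℂ] Matrix ι ι ℂ}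
    (hT : HasKraus T) {ρ E : Matrix (ι × κ) (ι × κ) ℂ} (hρ : ρ.PosSemidef) (hE : E.PosSemidef)
    (h : (ampl T ρ * E).trace = 0) (Z : Matrix (ι × κ') (ι × κ) ℂ) :
    ampl T (Z * ρ) * E = 0 := by
  classical
  obtain ⟨J, _, K, hK⟩ := hT
  rw [ampl_kraus hK] at h ⊢
  rw [Matrix.sum_mul]
  refine Finset.sum_eq_zero fun j _ => ?_
  have := congrArg Matrix.conjTranspose (mul_kraus_mul_eq_zero _ hρ hE h j)
  simp only [Matrix.conjTranspose_mul, hρ.isHermitian.eq, hE.isHermitian.eq,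
    Matrix.conjTranspose_zero] at this
  simp only [Matrix.mul_assoc]
  simp only [this, Matrix.mul_zero]

/-- The vectors of a rank-one decomposition of the Choi matrix, reshaped into matrices, are Kraus
operators. -/
theorem hasKraus_of_choi [DecidableEq ι] {T : Matrix ι ι ℂ →ₗ[ℂ] Matrix ι ι ℂ}
    (h : (Matrix.of fun p q : ι × ι => T (Matrix.single p.2 q.2 1) p.1 q.1).PosSemidef) :
    HasKraus T := by
  obtain ⟨N, v, hv⟩ := Matrix.posSemidef_iff_eq_sum_vecMulVec.mp h
  refine ⟨Fin N, inferInstance, fun l => Matrix.of fun i p => v l (i, p), fun X => ?_⟩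
  ext i j
  have hX : T X = ∑ p, ∑ q, X p q • T (Matrix.single p q 1) := by
    conv_lhs => rw [Matrix.matrix_eq_sum_single X]
    simp only [map_sum, ← map_smul, Matrix.smul_single, smul_eq_mul, mul_one]
  have hv' : ∀ p q, T (Matrix.single p q 1) i j = ∑ l, v l (i, p) * star (v l (j, q)) := by
    intro p q
    have := congrFun (congrFun hv (i, p)) (j, q)
    simpa [Matrix.sum_apply, Matrix.vecMulVec_apply] using this
  rw [hX]
  simp only [Matrix.sum_apply, Matrix.smul_apply, hv', Matrix.mul_apply, Matrix.of_apply,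
    Matrix.conjTranspose_apply, smul_eq_mul, Finset.mul_sum, Finset.sum_mul]
  rw [Finset.sum_comm' (t' := Finset.univ) (s' := fun _ => Finset.univ) (by simp)]
  conv_lhs => enter [2, q]; rw [Finset.sum_comm]
  rw [Finset.sum_comm]
  refine Finset.sum_congr rfl fun l _ => Finset.sum_congr rfl fun q _ =>
    Finset.sum_congr rfl fun p _ => by ring

theorem IsCompletelyPositive.hasKraus [DecidableEq ι] {T : Matrix ι ι ℂ →ₗ[ℂ] Matrix ι ι ℂ}
    (h : IsCompletelyPositive T) : HasKraus T := by
  let e := Fintype.equivFin ι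
  -- The unnormalised maximally entangled vector, whose image under the ampliation is the Choi
  -- matrix.
  let v : ι × Fin (Fintype.card ι) → ℂ := fun p => if e p.1 = p.2 then 1 else 0
  have h1 := (h _ _ (Matrix.posSemidef_vecMulVec_self_star v)).submatrix
    (fun p : ι × ι => (p.1, e p.2))
  apply hasKraus_of_choi
  convert h1 using 1
  ext ⟨i, p⟩ ⟨j, q⟩
  simp only [ampliation, Matrix.of_apply, Matrix.submatrix_apply]
  refine congrArg (fun Y => T Y i j) ?_
  ext x y
  by_cases hp : p = x <;> by_cases hq : q = y <;>
    simp [v, Matrix.vecMulVec_apply, hp, hq, eq_comm]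

end Kraus

/-! ### Conditional channels -/

section Conditional

variable {κ κ' : Type}

/-- The operator on the system obtained by fixing the indices of the ancilla. -/
def ancSlice (ρ : Matrix (Fin 2 × κ) (Fin 2 × κ') ℂ) (p : κ) (p' : κ') : Matrix (Fin 2) (Fin 2) ℂ :=
  Matrix.of fun i j => ρ (i, p) (j, p')

variable [Fintype κ]

/-- Alice's unnormalised channel `X ↦ Tr_B ((Φ ⊗ id)(X ⊗ σ) (1 ⊗ G))`, given that Bob prepares `σ`
and obtains the outcome with effect `G`. -/
noncomputable def condChannel (Φ : TwoQubitOp →ₗ[ℂ] TwoQubitOp)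
    (σ G : Matrix (Fin 2 × κ) (Fin 2 × κ) ℂ) :
    Matrix (Fin 2) (Fin 2) ℂ →ₗ[ℂ] Matrix (Fin 2) (Fin 2) ℂ where
  toFun X := Matrix.of fun i j => ∑ q, ∑ q', ∑ b, ∑ b',
    Φ (X ⊗ₖ ancSlice σ q q') (i, b) (j, b') * G (b', q') (b, q)
  map_add' X Y := by
    ext i j
    simp [Matrix.add_kronecker, add_mul, Finset.sum_add_distrib]
  map_smul' c X := by
    ext i j
    simp [Matrix.smul_kronecker, Finset.mul_sum, mul_assoc, mul_add]

theorem condChannel_apply (Φ : TwoQubitOp →ₗ[ℂ] TwoQubitOp)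
    (σ G : Matrix (Fin 2 × κ) (Fin 2 × κ) ℂ) (X : Matrix (Fin 2) (Fin 2) ℂ) (i j : Fin 2) :
    condChannel Φ σ G X i j = ∑ q, ∑ q', ∑ b, ∑ b',
      Φ (X ⊗ₖ ancSlice σ q q') (i, b) (j, b') * G (b', q') (b, q) := rfl

/-- The Kraus operators of `condChannel` before summation over the ancilla. -/
def condKraus (K : TwoQubitOp) (v u : Fin 2 × κ → ℂ) (q : κ) : Matrix (Fin 2) (Fin 2) ℂ :=
  Matrix.of fun i x => ∑ b, ∑ y, star (u (b, q)) * K (i, b) (x, y) * v (y, q)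

theorem condChannel_vecMulVec {Φ : TwoQubitOp →ₗ[ℂ] TwoQubitOp} {J : Type} [Fintype J]
    {K : J → TwoQubitOp} (hK : ∀ X, Φ X = ∑ j, K j * X * (K j)ᴴ) (v u : Fin 2 × κ → ℂ)
    (X : Matrix (Fin 2) (Fin 2) ℂ) :
    condChannel Φ (Matrix.vecMulVec v (star v)) (Matrix.vecMulVec u (star u)) X =
      ∑ l, (∑ q, condKraus (K l) v u q) * X * (∑ q, condKraus (K l) v u q)ᴴ := by
  ext i j
  simp only [Matrix.conjTranspose_sum, Matrix.mul_sum, condChannel_apply, hK,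
    Matrix.sum_apply, Finset.sum_mul]
  have h : ∀ l q q', ∑ b, ∑ b', (K l * (X ⊗ₖ ancSlice (Matrix.vecMulVec v (star v)) q q') * (K l)ᴴ)
      (i, b) (j, b') * Matrix.vecMulVec u (star u) (b', q') (b, q) =
      (condKraus (K l) v u q * X * (condKraus (K l) v u q')ᴴ) i j := by
    intro l q q'
    simp only [condKraus, ancSlice, Matrix.mul_apply, Fintype.sum_prod_type, Fin.sum_univ_two,
      Matrix.of_apply, Matrix.conjTranspose_apply, Matrix.kroneckerMap_apply,
      Matrix.vecMulVec_apply, Pi.star_apply, star_add, star_mul', star_star]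
    ring
  simp only [← h]
  simp only [← Finset.sum_comm (s := (Finset.univ : Finset J))]

theorem condChannel_sum_left (Φ : TwoQubitOp →ₗ[ℂ] TwoQubitOp) {S : Type} [Fintype S]
    (σ : S → Matrix (Fin 2 × κ) (Fin 2 × κ) ℂ) (G : Matrix (Fin 2 × κ) (Fin 2 × κ) ℂ)
    (X : Matrix (Fin 2) (Fin 2) ℂ) :
    condChannel Φ (∑ s, σ s) G X = ∑ s, condChannel Φ (σ s) G X := by
  have h : ∀ q q', X ⊗ₖ ancSlice (∑ s, σ s) q q' = ∑ s, X ⊗ₖ ancSlice (σ s) q q' := by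
    intro q q'
    ext ⟨i, j⟩ ⟨i', j'⟩
    simp [Matrix.sum_apply, Finset.mul_sum, ancSlice]
  ext i j
  simp only [condChannel_apply, h, map_sum, Matrix.sum_apply, Finset.sum_mul]
  simp only [← Finset.sum_comm (s := (Finset.univ : Finset S))]

theorem condChannel_sum_right (Φ : TwoQubitOp →ₗ[ℂ] TwoQubitOp) {S : Type} [Fintype S]
    (σ : Matrix (Fin 2 × κ) (Fin 2 × κ) ℂ) (G : S → Matrix (Fin 2 × κ) (Fin 2 × κ) ℂ)
    (X : Matrix (Fin 2) (Fin 2) ℂ) :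
    condChannel Φ σ (∑ s, G s) X = ∑ s, condChannel Φ σ (G s) X := by
  ext i j
  simp only [condChannel_apply, Matrix.sum_apply, Finset.mul_sum]
  simp only [← Finset.sum_comm (s := (Finset.univ : Finset S))]

theorem condChannel_hasKraus {Φ : TwoQubitOp →ₗ[ℂ] TwoQubitOp} (hΦ : HasKraus Φ)
    {σ G : Matrix (Fin 2 × κ) (Fin 2 × κ) ℂ} (hσ : σ.PosSemidef) (hG : G.PosSemidef) :
    HasKraus (condChannel Φ σ G) := by
  obtain ⟨J, _, K, hK⟩ := hΦ
  obtain ⟨s, v, rfl⟩ := Matrix.posSemidef_iff_eq_sum_vecMulVec.mp hσ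
  obtain ⟨t, u, rfl⟩ := Matrix.posSemidef_iff_eq_sum_vecMulVec.mp hG
  refine ⟨Fin t × Fin s × J, inferInstance,
    fun p => ∑ q, condKraus (K p.2.2) (v p.2.1) (u p.1) q, fun X => ?_⟩
  simp only [condChannel_sum_left, condChannel_sum_right, condChannel_vecMulVec hK, Fintype.sum_prod_type]

theorem condChannel_one [DecidableEq κ] (Φ : TwoQubitOp →ₗ[ℂ] TwoQubitOp)
    (σ : Matrix (Fin 2 × κ) (Fin 2 × κ) ℂ) (X : Matrix (Fin 2) (Fin 2) ℂ) :
    condChannel Φ σ 1 X = trSnd (Φ (X ⊗ₖ trSnd σ)) := by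
  have h : X ⊗ₖ trSnd σ = ∑ q, X ⊗ₖ ancSlice σ q q := by
    ext ⟨i, j⟩ ⟨i', j'⟩
    simp [Matrix.sum_apply, ancSlice, trSnd, Finset.mul_sum]
  ext i j
  rw [h]
  simp only [condChannel_apply, map_sum, Fin.sum_univ_two, Matrix.one_apply,
    Prod.mk.injEq]
  simp [trSnd, Finset.sum_add_distrib, Matrix.sum_apply]

theorem trace_condChannel (Φ : TwoQubitOp →ₗ[ℂ] TwoQubitOp)
    (σ G : Matrix (Fin 2 × κ) (Fin 2 × κ) ℂ) (X : Matrix (Fin 2) (Fin 2) ℂ) :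
    (condChannel Φ σ G X).trace = ∑ q, ∑ q', ∑ b, ∑ b',
      trFst (Φ (X ⊗ₖ ancSlice σ q q')) b b' * G (b', q') (b, q) := by
  simp only [Matrix.trace, Matrix.diag, condChannel_apply, trFst, Matrix.of_apply, Finset.sum_mul]
  simp only [← Finset.sum_add_distrib, Fin.sum_univ_two]
  refine Finset.sum_congr rfl fun q _ => Finset.sum_congr rfl fun q' _ => ?_
  ring

end Conditional

/-! ### Joint statistics and the exchange of the two parties -/

theorem trFst_kronecker (X Y : Matrix (Fin 2) (Fin 2) ℂ) : trFst (X ⊗ₖ Y) = X.trace • Y := by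
  ext i j
  simp [trFst, Matrix.trace, add_mul]

theorem trSnd_kronecker (X Y : Matrix (Fin 2) (Fin 2) ℂ) : trSnd (X ⊗ₖ Y) = Y.trace • X := by
  ext i j
  simp [trSnd, Matrix.trace, mul_comm, mul_add]

/-- `∑ Φ(ρ^{pp'} ⊗ σ^{qq'})_{(ab),(a'b')} E_{a'p',ap} G_{b'q',bq}`. -/
noncomputable def pairing {s t : ℕ} (Φ : TwoQubitOp →ₗ[ℂ] TwoQubitOp)
    (ρ E : Matrix (Fin 2 × Fin s) (Fin 2 × Fin s) ℂ)
    (σ G : Matrix (Fin 2 × Fin t) (Fin 2 × Fin t) ℂ) : ℂ :=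
  ∑ p, ∑ p', ∑ q, ∑ q', ∑ a, ∑ a', ∑ b, ∑ b',
    Φ (ancSlice ρ p p' ⊗ₖ ancSlice σ q q') (a, b) (a', b') * E (a', p') (a, p) * G (b', q') (b, q)

theorem trace_ampliation_regroup {s t : ℕ} (Φ : TwoQubitOp →ₗ[ℂ] TwoQubitOp)
    (ρ E : Matrix (Fin 2 × Fin s) (Fin 2 × Fin s) ℂ)
    (σ G : Matrix (Fin 2 × Fin t) (Fin 2 × Fin t) ℂ) :
    (ampliation Φ (regroup ρ σ) * regroup E G).trace = pairing Φ ρ E σ G := by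
  have h : ∀ p p' q q', (Matrix.of fun i j : Fin 2 × Fin 2 =>
      regroup ρ σ (i, (p, q)) (j, (p', q'))) = ancSlice ρ p p' ⊗ₖ ancSlice σ q q' := by
    intro p p' q q'
    ext ⟨i, j⟩ ⟨i', j'⟩
    simp [regroup, ancSlice]
  simp only [Matrix.trace, Matrix.diag, Matrix.mul_apply, ampliation, Matrix.of_apply,
    Fintype.sum_prod_type, h, pairing]
  simp only [regroup, Matrix.submatrix_apply, Equiv.prodProdProdComm_apply,
    Matrix.kroneckerMap_apply, ← Finset.sum_add_distrib, Fin.sum_univ_two]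
  refine Finset.sum_congr rfl fun p _ => ?_
  rw [Finset.sum_comm]
  refine Finset.sum_congr rfl fun p' _ => Finset.sum_congr rfl fun q _ =>
    Finset.sum_congr rfl fun q' _ => ?_
  ring

/-- The joint statistics can thus be read as Alice alone measuring her conditional channel, to which
the zero-probability lemmas apply. -/
theorem trace_ampl_condChannel {s t : ℕ} (Φ : TwoQubitOp →ₗ[ℂ] TwoQubitOp)
    (ρ E : Matrix (Fin 2 × Fin s) (Fin 2 × Fin s) ℂ)
    (σ G : Matrix (Fin 2 × Fin t) (Fin 2 × Fin t) ℂ) :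
    (ampl (condChannel Φ σ G) ρ * E).trace = pairing Φ ρ E σ G := by
  simp only [Matrix.trace, Matrix.diag, Matrix.mul_apply, ampl, Matrix.of_apply,
    Fintype.sum_prod_type, condChannel_apply, pairing]
  simp only [← ancSlice.eq_def]
  simp only [Fin.sum_univ_two, Finset.sum_mul, ← Finset.sum_add_distrib]
  refine Finset.sum_congr rfl fun p _ => ?_
  refine Finset.sum_congr rfl fun p' _ => Finset.sum_congr rfl fun q _ =>
    Finset.sum_congr rfl fun q' _ => ?_
  ring

/-- The channel with the roles of Alice and Bob exchanged. -/
def swapChannel (Φ : TwoQubitOp →ₗ[ℂ] TwoQubitOp) : TwoQubitOp →ₗ[ℂ] TwoQubitOp where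
  toFun X := (Φ (X.submatrix Prod.swap Prod.swap)).submatrix Prod.swap Prod.swap
  map_add' X Y := by simp [Matrix.submatrix_add]
  map_smul' c X := by simp [Matrix.submatrix_smul]

theorem swapChannel_apply (Φ : TwoQubitOp →ₗ[ℂ] TwoQubitOp) (X : TwoQubitOp) :
    swapChannel Φ X = (Φ (X.submatrix Prod.swap Prod.swap)).submatrix Prod.swap Prod.swap := rfl

theorem swap_kronecker (X Y : Matrix (Fin 2) (Fin 2) ℂ) :
    (X ⊗ₖ Y).submatrix Prod.swap Prod.swap = Y ⊗ₖ X := by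
  ext ⟨i, j⟩ ⟨i', j'⟩
  simp [mul_comm]

theorem pairing_swapChannel {s t : ℕ} (Φ : TwoQubitOp →ₗ[ℂ] TwoQubitOp)
    (ρ E : Matrix (Fin 2 × Fin s) (Fin 2 × Fin s) ℂ)
    (σ G : Matrix (Fin 2 × Fin t) (Fin 2 × Fin t) ℂ) :
    pairing (swapChannel Φ) σ G ρ E = pairing Φ ρ E σ G := by
  simp only [pairing, swapChannel_apply, swap_kronecker, Matrix.submatrix_apply, Prod.swap_prod_mk]
  simp only [Fin.sum_univ_two]
  refine ((Finset.sum_congr rfl fun q _ => Finset.sum_comm).trans (Finset.sum_comm.trans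
    (Finset.sum_congr rfl fun p _ => (Finset.sum_congr rfl fun q _ => Finset.sum_comm).trans
      Finset.sum_comm))).trans ?_
  refine Finset.sum_congr rfl fun p _ => Finset.sum_congr rfl fun p' _ =>
    Finset.sum_congr rfl fun q _ => Finset.sum_congr rfl fun q' _ => ?_
  ring

theorem HasKraus.swapChannel {Φ : TwoQubitOp →ₗ[ℂ] TwoQubitOp} (h : HasKraus Φ) :
    HasKraus (swapChannel Φ) := by
  obtain ⟨J, _, K, hK⟩ := h
  refine ⟨J, inferInstance, fun j => (K j).submatrix Prod.swap Prod.swap, fun X => ?_⟩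
  ext ⟨i, j⟩ ⟨i', j'⟩
  simp only [swapChannel_apply, hK, Matrix.submatrix_apply, Matrix.sum_apply, Matrix.mul_apply,
    Matrix.conjTranspose_apply, Fintype.sum_prod_type, Fin.sum_univ_two, Prod.swap_prod_mk]
  refine Finset.sum_congr rfl fun l _ => ?_
  ring

theorem trFst_swap (X : TwoQubitOp) : trFst (X.submatrix Prod.swap Prod.swap) = trSnd X := rfl

theorem trSnd_swap (X : TwoQubitOp) : trSnd (X.submatrix Prod.swap Prod.swap) = trFst X := rfl

theorem trace_swap (X : TwoQubitOp) : (X.submatrix Prod.swap Prod.swap).trace = X.trace := by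
  simp only [Matrix.trace, Matrix.diag, Fintype.sum_prod_type, Fin.sum_univ_two,
    Matrix.submatrix_apply, Prod.swap_prod_mk]
  ring

/-! ### Maximally violating correlations -/

/-- Each of the four correlations must be extremal, so eight probabilities vanish. Equality of
marginals carries `p` around the cycle of settings; the one setting of opposite parity closes it
with `p = 1 - p`. The sign of the CHSH value is recorded by `s`. -/
theorem prBox_of_chsh {p : Fin 2 → Fin 2 → Fin 2 → Fin 2 → ℝ} (h0 : ∀ k m i j, 0 ≤ p k m i j)
    (h1 : ∀ k m, ∑ i, ∑ j, p k m i j = 1)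
    (hA : ∀ k i, ∑ j, p k 0 i j = ∑ j, p k 1 i j) (hB : ∀ m j, ∑ i, p 0 m i j = ∑ i, p 1 m i j)
    (hc : |(p 0 0 0 0 - p 0 0 0 1 - p 0 0 1 0 + p 0 0 1 1)
      + (p 0 1 0 0 - p 0 1 0 1 - p 0 1 1 0 + p 0 1 1 1)
      + (p 1 0 0 0 - p 1 0 0 1 - p 1 0 1 0 + p 1 0 1 1)
      - (p 1 1 0 0 - p 1 1 0 1 - p 1 1 1 0 + p 1 1 1 1)| = 4) :
    ∃ s : Fin 2, ∀ k m i j, p k m i j = if i + j = s + k * m then 1 / 2 else 0 := by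
  simp only [Fin.sum_univ_two] at h1 hA hB
  have n := fun k m => And.intro (h0 k m 0 0) (And.intro (h0 k m 0 1)
    (And.intro (h0 k m 1 0) (h0 k m 1 1)))
  obtain ⟨a1, a2, a3, a4⟩ := n 0 0
  obtain ⟨b1, b2, b3, b4⟩ := n 0 1
  obtain ⟨c1, c2, c3, c4⟩ := n 1 0
  obtain ⟨d1, d2, d3, d4⟩ := n 1 1
  have s1 := h1 0 0
  have s2 := h1 0 1
  have s3 := h1 1 0
  have s4 := h1 1 1
  have e1 := hA 0 0
  have e2 := hA 0 1
  have e3 := hA 1 0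
  have e4 := hA 1 1
  have f1 := hB 0 0
  have f2 := hB 0 1
  have f3 := hB 1 0
  have f4 := hB 1 1
  clear n h0 h1 hA hB
  rcases eq_or_eq_neg_of_abs_eq hc with h | h
  · have z1 : p 0 0 0 1 = 0 := by linarith
    have z2 : p 0 0 1 0 = 0 := by linarith
    have z3 : p 0 1 0 1 = 0 := by linarith
    have z4 : p 0 1 1 0 = 0 := by linarith
    have z5 : p 1 0 0 1 = 0 := by linarith
    have z6 : p 1 0 1 0 = 0 := by linarith
    have z7 : p 1 1 0 0 = 0 := by linarith
    have z8 : p 1 1 1 1 = 0 := by linarith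
    refine ⟨0, ?_⟩
    simp only [Fin.forall_fin_two]
    simp only [z1, z2, z3, z4, z5, z6, z7, z8] at *
    simp
    refine ⟨⟨⟨?_, ?_⟩, ?_, ?_⟩, ⟨?_, ?_⟩, ?_, ?_⟩ <;> linarith
  · have z1 : p 0 0 0 0 = 0 := by linarith
    have z2 : p 0 0 1 1 = 0 := by linarith
    have z3 : p 0 1 0 0 = 0 := by linarith
    have z4 : p 0 1 1 1 = 0 := by linarith
    have z5 : p 1 0 0 0 = 0 := by linarith
    have z6 : p 1 0 1 1 = 0 := by linarith
    have z7 : p 1 1 0 1 = 0 := by linarith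
    have z8 : p 1 1 1 0 = 0 := by linarith
    refine ⟨1, ?_⟩
    simp only [Fin.forall_fin_two]
    simp only [z1, z2, z3, z4, z5, z6, z7, z8] at *
    simp
    refine ⟨⟨⟨?_, ?_⟩, ?_, ?_⟩, ⟨?_, ?_⟩, ?_, ?_⟩ <;> linarith

/-! ### Orthogonality of the reduced input states -/

theorem ampl_add {ι κ κ' : Type} (T T' : Matrix ι ι ℂ →ₗ[ℂ] Matrix ι ι ℂ)
    (X : Matrix (ι × κ) (ι × κ') ℂ) : ampl (T + T') X = ampl T X + ampl T' X := rfl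

theorem sum_ampl_apply {κ κ' : Type} (T : Matrix (Fin 2) (Fin 2) ℂ →ₗ[ℂ] Matrix (Fin 2) (Fin 2) ℂ)
    (hT : ∀ X, (T X).trace = X.trace) (X : Matrix (Fin 2 × κ) (Fin 2 × κ') ℂ) (p : κ) (p' : κ') :
    ∑ i, ampl T X (i, p) (i, p') = ∑ i, X (i, p) (i, p') :=
  hT (ancSlice X p p')

/-- The total channel `∑ j, T m j` is the same for both `m`, so for each block between `E 0 i` and
`E 1 i'` the more convenient `m` can be used. -/
theorem trSnd_mul_trSnd_eq_zero {s : Fin 2 → ℕ}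
    {ρ : ∀ k, Matrix (Fin 2 × Fin (s k)) (Fin 2 × Fin (s k)) ℂ} (hρ : ∀ k, (ρ k).PosSemidef)
    {E : ∀ k, Fin 2 → Matrix (Fin 2 × Fin (s k)) (Fin 2 × Fin (s k)) ℂ}
    (hE : ∀ k i, (E k i).PosSemidef) (hE1 : ∀ k, ∑ i, E k i = 1)
    {T : Fin 2 → Fin 2 → Matrix (Fin 2) (Fin 2) ℂ →ₗ[ℂ] Matrix (Fin 2) (Fin 2) ℂ}
    (hT : ∀ m j, HasKraus (T m j)) (hTsum : ∑ j, T 0 j = ∑ j, T 1 j)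
    (hTtr : ∀ X, ((∑ j, T 0 j) X).trace = X.trace)
    {t : Fin 2 → Fin 2 → Fin 2} (ht : t 0 0 + t 0 1 + t 1 0 + t 1 1 = 1)
    (h : ∀ k m i j, i + j ≠ t k m → (ampl (T m j) (ρ k) * E k i).trace = 0) :
    trSnd (ρ 1) * trSnd (ρ 0) = 0 := by
  have key : ∀ Z : Matrix (Fin 2 × Fin (s 0)) (Fin 2 × Fin (s 1)) ℂ,
      ampl (∑ j, T 0 j) (ρ 0 * Z * ρ 1) = 0 := by
    intro Z
    have hm : ∀ m, ampl (∑ j, T 0 j) (ρ 0 * Z * ρ 1) = ∑ j, ampl (T m j) (ρ 0 * Z * ρ 1) := by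
      intro m
      have : ∑ j, T 0 j = ∑ j, T m j := by fin_cases m <;> [rfl; exact hTsum]
      rw [this, Fin.sum_univ_two, Fin.sum_univ_two, ampl_add]
    have hz : ∀ i i', E 0 i * ampl (∑ j, T 0 j) (ρ 0 * Z * ρ 1) * E 1 i' = 0 := by
      intro i i'
      -- Both outcomes are compatible with some `j` only if `i + i' = t 0 m + t 1 m`. By `ht` the
      -- right side differs for the two values of `m`, so one of them violates this.
      obtain ⟨m, hm'⟩ : ∃ m, ∀ j, i + j ≠ t 0 m ∨ i' + j ≠ t 1 m := by
        simp only [Fin.exists_fin_two]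
        generalize t 0 0 = a at *
        generalize t 0 1 = b at *
        generalize t 1 0 = c at *
        generalize t 1 1 = d at *
        clear hm h
        revert a b c d i i'
        decide
      rw [hm m, Matrix.mul_sum, Matrix.sum_mul]
      refine Finset.sum_eq_zero fun j _ => ?_
      rcases hm' j with hj | hj
      · rw [Matrix.mul_assoc (ρ 0), mul_ampl_eq_zero (hT m j) (hρ 0) (hE 0 i) (h 0 m i j hj),
          Matrix.zero_mul]
      · rw [Matrix.mul_assoc, ampl_mul_eq_zero (hT m j) (hρ 1) (hE 1 i') (h 1 m i' j hj),
          Matrix.mul_zero]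
    calc ampl (∑ j, T 0 j) (ρ 0 * Z * ρ 1)
        = (∑ i, E 0 i) * ampl (∑ j, T 0 j) (ρ 0 * Z * ρ 1) * ∑ i', E 1 i' := by
          rw [hE1, hE1, Matrix.one_mul, Matrix.mul_one]
      _ = 0 := by simp only [Matrix.sum_mul, Matrix.mul_sum, hz, Finset.sum_const_zero]
  -- `Z` is a matrix unit here, and the partial trace over the qubit is preserved by the channel.
  have key2 : ∀ u v p p', ∑ i, ρ 0 (i, p) u * ρ 1 v (i, p') = 0 := by
    intro u v p p'
    have := sum_ampl_apply _ hTtr (ρ 0 * Matrix.single u v (1 : ℂ) * ρ 1) p p'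
    rw [key] at this
    simpa [Matrix.mul_apply, Matrix.single_apply, ite_and] using this.symm
  ext v u
  have : ∑ p, ∑ p', ∑ i, ρ 0 (i, p) (u, p) * ρ 1 (v, p') (i, p') = 0 := by simp only [key2]; simp
  rw [Finset.sum_comm] at this
  simp only [Matrix.mul_apply, trSnd, Matrix.of_apply, Finset.sum_mul_sum]
  simpa [Finset.sum_add_distrib, mul_comm] using this

/-! ### Orthonormal bases of the qubit space -/

/-- Orthonormal pairs of vectors. -/
def IsONB (f : Fin 2 → Fin 2 → ℂ) : Prop := ∀ i j, star (f i) ⬝ᵥ f j = if i = j then 1 else 0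

theorem ketbra_apply {ι : Type} (v w : ι → ℂ) (i j : ι) : ketbra v w i j = v i * star (w j) := rfl

theorem ketbra_mulVec {ι : Type} [Fintype ι] (v w u : ι → ℂ) :
    ketbra v w *ᵥ u = (star w ⬝ᵥ u) • v := by
  rw [ketbra, Matrix.vecMulVec_mulVec]
  simp

theorem mul_ketbra {ι : Type} [Fintype ι] (H : Matrix ι ι ℂ) (v w : ι → ℂ) :
    H * ketbra v w = ketbra (H *ᵥ v) w := by
  rw [ketbra, ketbra, Matrix.mul_vecMulVec]

theorem trace_ketbra {ι : Type} [Fintype ι] (v w : ι → ℂ) :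
    (ketbra v w).trace = star w ⬝ᵥ v := by
  rw [ketbra, Matrix.trace_vecMulVec, dotProduct_comm]

theorem conjTranspose_ketbra {ι : Type} (v w : ι → ℂ) : (ketbra v w)ᴴ = ketbra w v := by
  ext i j
  simp [ketbra_apply, mul_comm]

theorem IsONB.sum_ketbra {f : Fin 2 → Fin 2 → ℂ} (hf : IsONB f) : ∑ i, ketbra (f i) (f i) = 1 := by
  have h : (Matrix.of f).map star * (Matrix.of f)ᵀ = 1 := by
    ext i j
    simpa [Matrix.mul_apply, Matrix.one_apply, dotProduct] using hf i j
  have h2 := mul_eq_one_comm.mp h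
  ext i j
  have := congrFun (congrFun h2 i) j
  simpa [Matrix.mul_apply, ketbra_apply, Matrix.sum_apply] using this

theorem IsONB.eq_sum {f : Fin 2 → Fin 2 → ℂ} (hf : IsONB f) (v : Fin 2 → ℂ) :
    v = ∑ i, (star (f i) ⬝ᵥ v) • f i := by
  conv_lhs => rw [← Matrix.one_mulVec v, ← hf.sum_ketbra, Matrix.sum_mulVec]
  simp only [ketbra_mulVec]

theorem IsONB.comp {f : Fin 2 → Fin 2 → ℂ} (hf : IsONB f) (e : Equiv.Perm (Fin 2)) :
    IsONB (fun i => f (e i)) := by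
  intro i j
  simp [hf (e i) (e j)]

theorem IsONB.eq_smul_ketbra {f : Fin 2 → Fin 2 → ℂ} (hf : IsONB f)
    {H : Matrix (Fin 2) (Fin 2) ℂ} (h1 : H *ᵥ f 1 = 0) (h1' : star (f 1) ᵥ* H = 0) :
    H = H.trace • ketbra (f 0) (f 0) := by
  have h2 : H = ketbra (H *ᵥ f 0) (f 0) := by
    conv_lhs => rw [← Matrix.mul_one H, ← hf.sum_ketbra, Matrix.mul_sum]
    simp only [mul_ketbra, Fin.sum_univ_two, h1]
    ext i j
    simp [ketbra_apply]
  have h3 : star (f 1) ⬝ᵥ (H *ᵥ f 0) = 0 := by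
    rw [Matrix.dotProduct_mulVec, h1', zero_dotProduct]
  have h4 := hf.eq_sum (H *ᵥ f 0)
  rw [Fin.sum_univ_two, h3, zero_smul, add_zero] at h4
  have h5 : H.trace = star (f 0) ⬝ᵥ (H *ᵥ f 0) := by
    conv_lhs => rw [h2, trace_ketbra]
  rw [h5]
  conv_lhs => rw [h2, h4]
  ext i j
  simp [ketbra_apply, mul_assoc]

theorem IsONB.eq_ketbra {f : Fin 2 → Fin 2 → ℂ} (hf : IsONB f) {H : Matrix (Fin 2) (Fin 2) ℂ}
    (hH : H.IsHermitian) (h1 : H *ᵥ f 1 = 0) : H = H.trace • ketbra (f 0) (f 0) := by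
  refine hf.eq_smul_ketbra h1 ?_
  have : star (f 1) ᵥ* H = star (H *ᵥ f 1) := by rw [Matrix.star_mulVec, hH.eq]
  rw [this, h1, star_zero]

theorem exists_isONB_smul {v w : Fin 2 → ℂ} (hv : v ≠ 0) (hw : w ≠ 0) (h : star v ⬝ᵥ w = 0) :
    ∃ c d : ℂ, c ≠ 0 ∧ d ≠ 0 ∧ IsONB ![c • v, d • w] := by
  have hn : ∀ u : Fin 2 → ℂ, u ≠ 0 → ∃ c : ℂ, c ≠ 0 ∧ star (c • u) ⬝ᵥ (c • u) = 1 := by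
    intro u hu
    have h0 : WithLp.toLp 2 u ≠ 0 := by simpa using hu
    refine ⟨((‖WithLp.toLp 2 u‖ : ℝ) : ℂ)⁻¹, by simpa using h0, ?_⟩
    have h1 : star u ⬝ᵥ u = ((‖WithLp.toLp 2 u‖ : ℝ) : ℂ) ^ 2 := by
      have := inner_self_eq_norm_sq_to_K (𝕜 := ℂ) (WithLp.toLp 2 u)
      rw [EuclideanSpace.inner_eq_star_dotProduct, dotProduct_comm] at this
      simpa using this
    have h2 : ((‖WithLp.toLp 2 u‖ : ℝ) : ℂ) ≠ 0 := by simpa using h0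
    rw [star_smul, smul_dotProduct, dotProduct_smul, h1]
    simp only [star_inv₀, Complex.star_def, Complex.conj_ofReal, smul_eq_mul]
    field_simp
  obtain ⟨c, hc, hc1⟩ := hn v hv
  obtain ⟨d, hd, hd1⟩ := hn w hw
  have h' : star w ⬝ᵥ v = 0 := by
    rw [Matrix.star_dotProduct, h, star_zero]
  refine ⟨c, d, hc, hd, ?_⟩
  simp only [IsONB, Fin.forall_fin_two, Matrix.cons_val_zero, Matrix.cons_val_one, hc1, hd1]
  simp [h, h', star_smul, smul_dotProduct, dotProduct_smul]

theorem exists_mulVec_ne_zero {H : Matrix (Fin 2) (Fin 2) ℂ} (hH : H ≠ 0) :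
    ∃ u, H *ᵥ u ≠ 0 := by
  by_contra! h
  exact hH (Matrix.ext_of_mulVec_single fun i => by rw [h, Matrix.zero_mulVec])

/-- Nonzero vectors from the two ranges are orthogonal and hence, once normalised, a basis. Each
operator kills the other's vector, and its trace fixes the remaining coefficient. -/
theorem exists_isONB_of_mul_eq_zero {P Q : Matrix (Fin 2) (Fin 2) ℂ} (hP : P.IsHermitian)
    (hQ : Q.IsHermitian) (hP1 : P.trace = 1) (hQ1 : Q.trace = 1) (h : Q * P = 0) :
    ∃ f, IsONB f ∧ P = ketbra (f 0) (f 0) ∧ Q = ketbra (f 1) (f 1) := by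
  have h' : P * Q = 0 := by
    have := congrArg Matrix.conjTranspose h
    rwa [Matrix.conjTranspose_mul, hP.eq, hQ.eq, Matrix.conjTranspose_zero] at this
  obtain ⟨u, hu⟩ := exists_mulVec_ne_zero (H := P) (by rintro rfl; simp at hP1)
  obtain ⟨v, hv⟩ := exists_mulVec_ne_zero (H := Q) (by rintro rfl; simp at hQ1)
  obtain ⟨c, d, hc, hd, hf⟩ := exists_isONB_smul hu hv (by
    rw [Matrix.star_mulVec, hP.eq, ← Matrix.dotProduct_mulVec, Matrix.mulVec_mulVec, h']
    simp)
  refine ⟨_, hf, ?_, ?_⟩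
  · have := hf.eq_ketbra hP (by
      rw [Matrix.cons_val_one, Matrix.cons_val_zero, Matrix.mulVec_smul, Matrix.mulVec_mulVec, h',
        Matrix.zero_mulVec, smul_zero])
    rwa [hP1, one_smul] at this
  · have := (hf.comp (Equiv.swap 0 1)).eq_ketbra hQ
      (by
      rw [Equiv.swap_apply_right, Matrix.cons_val_zero, Matrix.mulVec_smul, Matrix.mulVec_mulVec, h,
        Matrix.zero_mulVec, smul_zero])
    rw [hQ1, one_smul] at this
    simpa using this

theorem exists_isONB_of_add_eq_one {F : Fin 2 → Matrix (Fin 2) (Fin 2) ℂ}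
    (hF : ∀ i, (F i).IsHermitian) (hF1 : ∑ i, F i = 1)
    {v : Fin 2 → Fin 2 → ℂ} (hv : ∀ i, v i ≠ 0) (h : ∀ i, F i *ᵥ v i = 0) :
    ∃ f, IsONB f ∧ ∀ i, F i = ketbra (f i) (f i) := by
  have h1 : ∀ u, F 0 *ᵥ u + F 1 *ᵥ u = u := by
    intro u
    rw [← Matrix.add_mulVec, ← Fin.sum_univ_two, hF1, Matrix.one_mulVec]
  have h2 : F 0 *ᵥ v 1 = v 1 := by simpa [h 1] using h1 (v 1)
  have h3 : F 1 *ᵥ v 0 = v 0 := by simpa [h 0] using h1 (v 0)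
  -- The order is reversed: the range of `F 0` is spanned by `v 1`, which `F 1` annihilates.
  obtain ⟨c, d, hc, hd, hf⟩ := exists_isONB_smul (hv 1) (hv 0) (by
    rw [← h2, Matrix.star_mulVec, (hF 0).eq, ← Matrix.dotProduct_mulVec, h 0]
    simp)
  have key : ∀ {f : Fin 2 → Fin 2 → ℂ} {G : Matrix (Fin 2) (Fin 2) ℂ}, IsONB f → G.IsHermitian →
      G *ᵥ f 1 = 0 → G *ᵥ f 0 = f 0 → G = ketbra (f 0) (f 0) := by
    intro f G hf hG h1 h0
    have h5 := hf.eq_ketbra hG h1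
    have h6 : G.trace • f 0 = f 0 := by
      have h00 := hf 0 0
      simp only [if_true] at h00
      have := h0
      rwa [h5, Matrix.smul_mulVec, ketbra_mulVec, h00, one_smul] at this
    have h7 : G.trace = 1 := by
      have h00 := hf 0 0
      rw [if_pos rfl] at h00
      have := congrArg (fun u => star (f 0) ⬝ᵥ u) h6
      simpa [h00] using this
    rwa [h7, one_smul] at h5
  refine ⟨_, hf, ?_⟩
  rw [Fin.forall_fin_two]
  constructor
  · exact key hf (hF 0) (by simp [Matrix.mulVec_smul, h 0]) (by simp [Matrix.mulVec_smul, h2])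
  · simpa using key (hf.comp (Equiv.swap 0 1)) (hF 1) (by simp [Matrix.mulVec_smul, h 1])
      (by simp [Matrix.mulVec_smul, h3])

/-! ### Elimination of the ancillas -/

theorem star_dotProduct_self_of_isONB {f : Fin 2 → Fin 2 → ℂ} (hf : IsONB f) (i : Fin 2) :
    star (f i) ⬝ᵥ f i = 1 := by
  simpa using hf i i

theorem trace_trSnd_mul {s : ℕ} (ρ : Matrix (Fin 2 × Fin s) (Fin 2 × Fin s) ℂ)
    (Q : Matrix (Fin 2) (Fin 2) ℂ) :
    (ρ * (Q ⊗ₖ (1 : Matrix (Fin s) (Fin s) ℂ))).trace = (trSnd ρ * Q).trace := by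
  simp only [Matrix.trace, Matrix.diag, Matrix.mul_apply, trSnd, Matrix.of_apply,
    Fintype.sum_prod_type, Matrix.kroneckerMap_apply, Matrix.one_apply, Fin.sum_univ_two,
    Finset.sum_mul, ← Finset.sum_add_distrib]
  simp [Finset.sum_add_distrib]

theorem posSemidef_trFst {s : ℕ} {ρ : Matrix (Fin 2 × Fin s) (Fin 2 × Fin s) ℂ}
    (hρ : ρ.PosSemidef) : (trFst ρ).PosSemidef := by
  have : trFst ρ = ∑ i, ρ.submatrix (fun p => (i, p)) (fun p => (i, p)) := by
    ext p q
    simp [trFst]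
  rw [this]
  exact Matrix.posSemidef_sum _ fun i _ => hρ.submatrix _

theorem trace_trFst {s : ℕ} (ρ : Matrix (Fin 2 × Fin s) (Fin 2 × Fin s) ℂ) :
    (trFst ρ).trace = ρ.trace := by
  simp only [Matrix.trace, Matrix.diag, trFst, Matrix.of_apply, Fintype.sum_prod_type]
  exact Finset.sum_comm

theorem trace_trSnd {s : ℕ} (ρ : Matrix (Fin 2 × Fin s) (Fin 2 × Fin s) ℂ) :
    (trSnd ρ).trace = ρ.trace := by
  simp only [Matrix.trace, Matrix.diag, trSnd, Matrix.of_apply, Fintype.sum_prod_type]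

theorem isHermitian_trSnd {s : ℕ} {ρ : Matrix (Fin 2 × Fin s) (Fin 2 × Fin s) ℂ}
    (hρ : ρ.PosSemidef) : (trSnd ρ).IsHermitian := by
  ext i j
  simp only [Matrix.conjTranspose_apply, trSnd, Matrix.of_apply, star_sum, hρ.isHermitian.apply]

/-- A state with a pure marginal is a product: it has expectation zero in `|f 1⟩⟨f 1| ⊗ 1`, so by
positivity this projection annihilates it. The coefficient is the trace of the slice. -/
theorem ancSlice_eq_smul {s : ℕ} {ρ : Matrix (Fin 2 × Fin s) (Fin 2 × Fin s) ℂ}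
    (hρ : ρ.PosSemidef) {f : Fin 2 → Fin 2 → ℂ} (hf : IsONB f)
    (h : trSnd ρ = ketbra (f 0) (f 0)) (p p' : Fin s) :
    ancSlice ρ p p' = trFst ρ p p' • ketbra (f 0) (f 0) := by
  have hQ : (ketbra (f 1) (f 1) ⊗ₖ (1 : Matrix (Fin s) (Fin s) ℂ)).PosSemidef :=
    (Matrix.posSemidef_vecMulVec_self_star (f 1)).kronecker Matrix.PosSemidef.one
  have h0 : (ketbra (f 1) (f 1) ⊗ₖ (1 : Matrix (Fin s) (Fin s) ℂ)) * ρ = 0 := by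
    apply hρ.mul_eq_zero_of_trace hQ
    rw [trace_trSnd_mul, h, mul_ketbra, ketbra_mulVec, hf 0 1]
    simp [ketbra]
  have h1 : ∀ p p', star (f 1) ᵥ* ancSlice ρ p p' = 0 := by
    intro p p'
    have h2 : ketbra (f 1) (f 1) * ancSlice ρ p p' = 0 := by
      ext i j
      have := congrFun (congrFun h0 (i, p)) (j, p')
      simpa [Matrix.mul_apply, Fintype.sum_prod_type, Matrix.one_apply, ancSlice] using this
    have h3 := congrArg (fun M => star (f 1) ᵥ* M) h2
    simpa [ketbra, Matrix.vecMulVec_mul, Matrix.vecMul_vecMulVec,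
      star_dotProduct_self_of_isONB hf] using h3
  refine hf.eq_smul_ketbra ?_ (h1 p p')
  have h4 : ancSlice ρ p p' = (ancSlice ρ p' p)ᴴ := by
    ext i j
    simp only [ancSlice, Matrix.conjTranspose_apply, Matrix.of_apply, hρ.isHermitian.apply]
  rw [h4, ← star_star (f 1), ← Matrix.star_vecMul, h1 p' p, star_zero]

/-- The effect on the qubit obtained from an effect on the qubit and an ancilla in the state
`τ`. -/
def reducedEffect {s : ℕ} (τ : Matrix (Fin s) (Fin s) ℂ)
    (E : Matrix (Fin 2 × Fin s) (Fin 2 × Fin s) ℂ) : Matrix (Fin 2) (Fin 2) ℂ :=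
  Matrix.of fun i j => ∑ p, ∑ p', E (i, p) (j, p') * τ p' p

theorem posSemidef_reducedEffect {s : ℕ} {τ : Matrix (Fin s) (Fin s) ℂ}
    {E : Matrix (Fin 2 × Fin s) (Fin 2 × Fin s) ℂ} (hτ : τ.PosSemidef) (hE : E.PosSemidef) :
    (reducedEffect τ E).PosSemidef := by
  obtain ⟨n, v, rfl⟩ := Matrix.posSemidef_iff_eq_sum_vecMulVec.mp hτ
  -- `V l` is the map `x ↦ x ⊗ v l`; compressing `E` by these maps preserves positivity.
  let V : Fin n → Matrix (Fin 2 × Fin s) (Fin 2) ℂ := fun l =>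
    Matrix.of fun x j => if x.1 = j then v l x.2 else 0
  have : reducedEffect (∑ i, Matrix.vecMulVec (v i) (star (v i))) E =
      ∑ l, (V l)ᴴ * E * V l := by
    ext i j
    simp only [reducedEffect, Matrix.of_apply, Matrix.sum_apply, Finset.mul_sum]
    simp only [← Finset.sum_comm (s := (Finset.univ : Finset (Fin n)))]
    refine Finset.sum_congr rfl fun l _ => ?_
    have h1 : ∀ i q, ((V l)ᴴ * E) i q = ∑ p, star (v l p) * E (i, p) q := by
      intro i q
      fin_cases i <;> simp [Matrix.mul_apply, V, Fintype.sum_prod_type]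
    have h2 : ((V l)ᴴ * E * V l) i j = ∑ p', (∑ p, star (v l p) * E (i, p) (j, p')) * v l p' := by
      rw [Matrix.mul_apply]
      simp only [h1]
      fin_cases j <;> simp [V, Fintype.sum_prod_type]
    rw [h2, Finset.sum_comm]
    refine Finset.sum_congr rfl fun p' _ => ?_
    rw [Finset.sum_mul]
    refine Finset.sum_congr rfl fun p _ => ?_
    rw [Matrix.vecMulVec_apply, Pi.star_apply]
    ring
  rw [this]
  exact Matrix.posSemidef_sum _ fun l _ => hE.conjTranspose_mul_mul_same _

theorem sum_reducedEffect {s : ℕ} {τ : Matrix (Fin s) (Fin s) ℂ} (hτ : τ.trace = 1)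
    {E : Fin 2 → Matrix (Fin 2 × Fin s) (Fin 2 × Fin s) ℂ} (hE : ∑ i, E i = 1) :
    ∑ i, reducedEffect τ (E i) = 1 := by
  have : ∑ i, reducedEffect τ (E i) = reducedEffect τ (∑ i, E i) := by
    ext i j
    simp only [reducedEffect, Fin.sum_univ_two, Matrix.add_apply, Matrix.of_apply, add_mul,
      Finset.sum_add_distrib]
  rw [this, hE]
  ext i j
  simp only [reducedEffect, Matrix.of_apply, Matrix.one_apply, Prod.mk.injEq]
  by_cases h : i = j
  · simpa [h, Matrix.trace] using hτ
  · simp [h]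

theorem trace_ampl_mul_of_ancSlice {s : ℕ}
    (T : Matrix (Fin 2) (Fin 2) ℂ →ₗ[ℂ] Matrix (Fin 2) (Fin 2) ℂ)
    {ρ : Matrix (Fin 2 × Fin s) (Fin 2 × Fin s) ℂ} {τ : Matrix (Fin s) (Fin s) ℂ}
    {A : Matrix (Fin 2) (Fin 2) ℂ} (h : ∀ p p', ancSlice ρ p p' = τ p p' • A)
    (E : Matrix (Fin 2 × Fin s) (Fin 2 × Fin s) ℂ) :
    (ampl T ρ * E).trace = (T A * reducedEffect τ E).trace := by
  have h2 : ∀ i p j p', ampl T ρ (i, p) (j, p') = τ p p' * T A i j := by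
    intro i p j p'
    change T (ancSlice ρ p p') i j = _
    rw [h, map_smul]
    rfl
  simp only [Matrix.trace, Matrix.diag, Matrix.mul_apply, h2, reducedEffect, Matrix.of_apply,
    Fintype.sum_prod_type, Fin.sum_univ_two, Finset.mul_sum, ← Finset.sum_add_distrib]
  rw [Finset.sum_comm]
  refine Finset.sum_congr rfl fun p _ => Finset.sum_congr rfl fun p' _ => ?_
  ring

theorem pairing_of_ancSlice {s t : ℕ} (Φ : TwoQubitOp →ₗ[ℂ] TwoQubitOp)
    {ρ : Matrix (Fin 2 × Fin s) (Fin 2 × Fin s) ℂ} {τ : Matrix (Fin s) (Fin s) ℂ}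
    {A : Matrix (Fin 2) (Fin 2) ℂ} (hρ : ∀ p p', ancSlice ρ p p' = τ p p' • A)
    {σ : Matrix (Fin 2 × Fin t) (Fin 2 × Fin t) ℂ} {υ : Matrix (Fin t) (Fin t) ℂ}
    {B : Matrix (Fin 2) (Fin 2) ℂ} (hσ : ∀ p p', ancSlice σ p p' = υ p p' • B)
    (E : Matrix (Fin 2 × Fin s) (Fin 2 × Fin s) ℂ)
    (G : Matrix (Fin 2 × Fin t) (Fin 2 × Fin t) ℂ) :
    pairing Φ ρ E σ G = (Φ (A ⊗ₖ B) * (reducedEffect τ E ⊗ₖ reducedEffect υ G)).trace := by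
  rw [← trace_ampl_condChannel, trace_ampl_mul_of_ancSlice _ hρ]
  simp only [condChannel_apply, hσ, Matrix.kronecker_smul, map_smul, Matrix.smul_apply, smul_eq_mul,
    Matrix.trace, Matrix.diag, Matrix.mul_apply, Fintype.sum_prod_type, Matrix.kroneckerMap_apply]
  generalize Φ (A ⊗ₖ B) = X
  generalize reducedEffect τ E = F
  simp only [reducedEffect, Matrix.of_apply, Fin.sum_univ_two, Finset.mul_sum, Finset.sum_mul,
    ← Finset.sum_add_distrib]
  rw [Finset.sum_comm]
  refine Finset.sum_congr rfl fun q _ => Finset.sum_congr rfl fun q' _ => ?_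
  ring

/-- Structure of one party's measurements. -/
theorem exists_reduced_measurement {s : Fin 2 → ℕ}
    {ρ : ∀ k, Matrix (Fin 2 × Fin (s k)) (Fin 2 × Fin (s k)) ℂ} (hρ : ∀ k, (ρ k).PosSemidef)
    (hρ1 : ∀ k, (ρ k).trace = 1)
    {E : ∀ k, Fin 2 → Matrix (Fin 2 × Fin (s k)) (Fin 2 × Fin (s k)) ℂ}
    (hE : ∀ k i, (E k i).PosSemidef) (hE1 : ∀ k, ∑ i, E k i = 1)
    {T : Fin 2 → Fin 2 → Matrix (Fin 2) (Fin 2) ℂ →ₗ[ℂ] Matrix (Fin 2) (Fin 2) ℂ}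
    (hT : ∀ m j, HasKraus (T m j)) (hTsum : ∑ j, T 0 j = ∑ j, T 1 j)
    (hTtr : ∀ X, ((∑ j, T 0 j) X).trace = X.trace)
    {t : Fin 2 → Fin 2 → Fin 2} (ht : t 0 0 + t 0 1 + t 1 0 + t 1 1 = 1)
    (h : ∀ k m i j, (ampl (T m j) (ρ k) * E k i).trace = if i + j = t k m then 1 / 2 else 0) :
    ∃ (a : Fin 2 → Fin 2 → ℂ) (f : Fin 2 → Fin 2 → Fin 2 → ℂ), IsONB a ∧ (∀ k, IsONB (f k)) ∧ (∀ k, trSnd (ρ k) = ketbra (a k) (a k)) ∧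
      (∀ k p p', ancSlice (ρ k) p p' = trFst (ρ k) p p' • ketbra (a k) (a k)) ∧
      ∀ k i, reducedEffect (trFst (ρ k)) (E k i) = ketbra (f k i) (f k i) := by
  obtain ⟨a, ha, ha0, ha1⟩ := exists_isONB_of_mul_eq_zero (isHermitian_trSnd (hρ 0))
    (isHermitian_trSnd (hρ 1)) (by rw [trace_trSnd, hρ1]) (by rw [trace_trSnd, hρ1])
    (trSnd_mul_trSnd_eq_zero hρ hE hE1 hT hTsum hTtr ht
      fun k m i j hij => by rw [h, if_neg hij])
  have hs : ∀ k p p', ancSlice (ρ k) p p' = trFst (ρ k) p p' • ketbra (a k) (a k) := by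
    rw [Fin.forall_fin_two]
    exact ⟨ancSlice_eq_smul (hρ 0) ha ha0,
      by simpa using ancSlice_eq_smul (hρ 1) (ha.comp (Equiv.swap 0 1)) (by simpa using ha1)⟩
  have hF : ∀ k, ∃ f, IsONB f ∧
      ∀ i, reducedEffect (trFst (ρ k)) (E k i) = ketbra (f i) (f i) := by
    intro k
    have hP := fun i => posSemidef_reducedEffect (posSemidef_trFst (hρ k)) (hE k i)
    have hv : ∀ i, ∃ v, v ≠ 0 ∧ reducedEffect (trFst (ρ k)) (E k i) *ᵥ v = 0 := by
      intro i
      -- Given Bob's outcome `j`, outcome `i` is impossible while `i'` does occur. So the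
      -- conditional output is nonzero, and the effect of `i` kills its range.
      obtain ⟨j, i', hj, hi'⟩ : ∃ j i', i + j ≠ t k 0 ∧ i' + j = t k 0 := by
        generalize t k 0 = c
        revert i c
        decide
      have h1 := trace_ampl_mul_of_ancSlice (T 0 j) (hs k) (E k i)
      rw [h, if_neg hj] at h1
      have h2 := trace_ampl_mul_of_ancSlice (T 0 j) (hs k) (E k i')
      rw [h, if_pos hi'] at h2
      have h3 := ((hT 0 j).posSemidef (Matrix.posSemidef_vecMulVec_self_star (a k))).mul_eq_zero_of_trace
        (hP i) h1.symm
      obtain ⟨u, hu⟩ := exists_mulVec_ne_zero (H := T 0 j (ketbra (a k) (a k))) (by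
        intro h4
        rw [h4] at h2
        simp at h2)
      exact ⟨_, hu, by rw [Matrix.mulVec_mulVec]; erw [h3]; rw [Matrix.zero_mulVec]⟩
    choose v hv0 hv1 using hv
    exact exists_isONB_of_add_eq_one (fun i => (hP i).isHermitian)
      (sum_reducedEffect (by rw [trace_trFst, hρ1]) (hE1 k)) hv0 hv1
  choose f hf hf' using hF
  exact ⟨a, f, ha, hf, Fin.forall_fin_two.mpr ⟨ha0, ha1⟩, hs, hf'⟩

/-! ### Correlations of non-signaling channels -/

/-- Non-signaling channels, with complete positivity in the form of a Kraus decomposition. -/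
structure IsNonSignalingKraus (Φ : TwoQubitOp →ₗ[ℂ] TwoQubitOp) : Prop where
  hasKraus : HasKraus Φ
  trace_eq : ∀ X, (Φ X).trace = X.trace
  trFst_eq : ∀ X Y, trFst X = trFst Y → trFst (Φ X) = trFst (Φ Y)
  trSnd_eq : ∀ X Y, trSnd X = trSnd Y → trSnd (Φ X) = trSnd (Φ Y)

theorem IsNonSignalingChannel.isNonSignalingKraus {Φ : TwoQubitOp →ₗ[ℂ] TwoQubitOp}
    (h : IsNonSignalingChannel Φ) : IsNonSignalingKraus Φ :=
  ⟨h.isChannel.completelyPositive.hasKraus, h.isChannel.tracePreserving, h.noSignalAB,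
    h.noSignalBA⟩

namespace IsNonSignalingKraus

variable {Φ : TwoQubitOp →ₗ[ℂ] TwoQubitOp}

theorem swapChannel (h : IsNonSignalingKraus Φ) : IsNonSignalingKraus (swapChannel Φ) where
  hasKraus := h.hasKraus.swapChannel
  trace_eq X := by rw [swapChannel_apply, trace_swap, h.trace_eq, trace_swap]
  trFst_eq X Y hXY := by
    simp only [swapChannel_apply, trFst_swap]
    exact h.trSnd_eq _ _ hXY
  trSnd_eq X Y hXY := by
    simp only [swapChannel_apply, trSnd_swap]
    exact h.trFst_eq _ _ hXY

variable {s t : ℕ}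

/-- No signaling from Bob to Alice: once his outcome is ignored, only the trace of his input
matters. -/
theorem condChannel_one_eq (h : IsNonSignalingKraus Φ)
    {σ : Matrix (Fin 2 × Fin s) (Fin 2 × Fin s) ℂ} {σ' : Matrix (Fin 2 × Fin t) (Fin 2 × Fin t) ℂ}
    (hσ : σ.trace = 1) (hσ' : σ'.trace = 1) : condChannel Φ σ 1 = condChannel Φ σ' 1 := by
  refine LinearMap.ext fun X => ?_
  rw [condChannel_one, condChannel_one]
  apply h.trSnd_eq
  rw [trSnd_kronecker, trSnd_kronecker, trace_trSnd, trace_trSnd, hσ, hσ']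

theorem trace_condChannel_one (h : IsNonSignalingKraus Φ)
    {σ : Matrix (Fin 2 × Fin s) (Fin 2 × Fin s) ℂ} (hσ : σ.trace = 1)
    (X : Matrix (Fin 2) (Fin 2) ℂ) : (condChannel Φ σ 1 X).trace = X.trace := by
  rw [condChannel_one, trace_trSnd, h.trace_eq, ← trace_trSnd, trSnd_kronecker, trace_trSnd, hσ,
    one_smul]

theorem trace_condChannel_eq (h : IsNonSignalingKraus Φ)
    (σ G : Matrix (Fin 2 × Fin s) (Fin 2 × Fin s) ℂ) {X Y : Matrix (Fin 2) (Fin 2) ℂ}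
    (hXY : X.trace = Y.trace) : (condChannel Φ σ G X).trace = (condChannel Φ σ G Y).trace := by
  have : ∀ q q', trFst (Φ (X ⊗ₖ ancSlice σ q q')) = trFst (Φ (Y ⊗ₖ ancSlice σ q q')) := by
    intro q q'
    apply h.trFst_eq
    rw [trFst_kronecker, trFst_kronecker, hXY]
  simp only [trace_condChannel, this]

end IsNonSignalingKraus

theorem sum_pairing {s t : ℕ} (Φ : TwoQubitOp →ₗ[ℂ] TwoQubitOp)
    (ρ : Matrix (Fin 2 × Fin s) (Fin 2 × Fin s) ℂ)
    {E : Fin 2 → Matrix (Fin 2 × Fin s) (Fin 2 × Fin s) ℂ} (hE : ∑ i, E i = 1)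
    (σ G : Matrix (Fin 2 × Fin t) (Fin 2 × Fin t) ℂ) :
    ∑ i, pairing Φ ρ (E i) σ G = (condChannel Φ σ G (trSnd ρ)).trace := by
  simp only [← trace_ampl_condChannel]
  rw [← Matrix.trace_sum, ← Matrix.mul_sum, hE, Matrix.mul_one]
  have h : trSnd ρ = ∑ p, ancSlice ρ p p := by
    ext i j
    simp [trSnd, ancSlice, Matrix.sum_apply]
  rw [h, map_sum, Matrix.trace_sum]
  simp only [Matrix.trace, Matrix.diag, ampl, Matrix.of_apply, Fintype.sum_prod_type]
  exact Finset.sum_comm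

/-- The effect of the outcome `1` (index `0`) or `-1` (index `1`). -/
def ChannelMeasurement.effect (M : ChannelMeasurement) (i : Fin 2) :
    Matrix (Fin 2 × Fin M.anc) (Fin 2 × Fin M.anc) ℂ :=
  if i = 0 then M.eff else 1 - M.eff

theorem ChannelMeasurement.sum_effect (M : ChannelMeasurement) : ∑ i, M.effect i = 1 := by
  simp [effect]

theorem ChannelMeasurement.posSemidef_effect (M : ChannelMeasurement) (i : Fin 2) :
    (M.effect i).PosSemidef := by
  unfold effect
  split_ifs
  exacts [M.eff_pos, M.eff_le_one]

theorem correlation_eq (Φ : TwoQubitOp →ₗ[ℂ] TwoQubitOp) (C D : ChannelMeasurement) :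
    correlation Φ C D = (pairing Φ C.input (C.effect 0) D.input (D.effect 0)).re
      - (pairing Φ C.input (C.effect 0) D.input (D.effect 1)).re
      - (pairing Φ C.input (C.effect 1) D.input (D.effect 0)).re
      + (pairing Φ C.input (C.effect 1) D.input (D.effect 1)).re := by
  have h : (-1 : ℤˣ) ≠ 1 := by decide
  simp only [correlation, outcomeProb, trace_ampliation_regroup, ChannelMeasurement.outcome,
    ChannelMeasurement.effect, if_neg h, if_true, one_ne_zero, if_false]

theorem IsNonSignalingKraus.pairing_eq_re {Φ : TwoQubitOp →ₗ[ℂ] TwoQubitOp}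
    (h : IsNonSignalingKraus Φ) (C D : ChannelMeasurement) (i j : Fin 2) :
    0 ≤ (pairing Φ C.input (C.effect i) D.input (D.effect j)).re ∧
      pairing Φ C.input (C.effect i) D.input (D.effect j) =
        ((pairing Φ C.input (C.effect i) D.input (D.effect j)).re : ℂ) := by
  have := ((condChannel_hasKraus h.hasKraus D.input_pos
    (D.posSemidef_effect j)).ampl_posSemidef C.input_pos).trace_mul_nonneg (C.posSemidef_effect i)
  rw [trace_ampl_condChannel] at this
  rw [Complex.le_def] at this
  exact ⟨this.1, Complex.ext rfl (by simpa using this.2.symm)⟩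

/-- Under maximal violation the statistics are those of a PR box. -/
theorem IsPRChannelWith.exists_pairing_eq {Φ : TwoQubitOp →ₗ[ℂ] TwoQubitOp}
    {A A' B B' : ChannelMeasurement} (h : IsPRChannelWith Φ A A' B B') :
    ∃ s : Fin 2, ∀ k m i j, pairing Φ ((![A, A'] : Fin 2 → ChannelMeasurement) k).input
      ((![A, A'] k).effect i) ((![B, B'] : Fin 2 → ChannelMeasurement) m).input
      ((![B, B'] m).effect j) = if i + j = s + k * m then 1 / 2 else 0 := by
  have hΦ := h.nonSignaling.isNonSignalingKraus
  have hc := h.maxViolation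
  rw [chsh, correlation_eq, correlation_eq, correlation_eq, correlation_eq] at hc
  generalize hM : ![A, A'] = M
  generalize hN : ![B, B'] = N
  obtain rfl : M 0 = A := by rw [← hM]; rfl
  obtain rfl : M 1 = A' := by rw [← hM]; rfl
  obtain rfl : N 0 = B := by rw [← hN]; rfl
  obtain rfl : N 1 = B' := by rw [← hN]; rfl
  have hA : ∀ k m i, ∑ j, pairing Φ (M k).input ((M k).effect i) (N m).input ((N m).effect j) =
      (condChannel (swapChannel Φ) (M k).input ((M k).effect i) (trSnd (N m).input)).trace := by
    intro k m i
    rw [← sum_pairing (swapChannel Φ) (N m).input (N m).sum_effect]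
    simp only [pairing_swapChannel]
  have hB : ∀ k m j, ∑ i, pairing Φ (M k).input ((M k).effect i) (N m).input ((N m).effect j) =
      (condChannel Φ (N m).input ((N m).effect j) (trSnd (M k).input)).trace := fun k m j =>
    sum_pairing Φ (M k).input (M k).sum_effect _ _
  obtain ⟨s, hs⟩ := prBox_of_chsh
    (p := fun k m i j => (pairing Φ (M k).input ((M k).effect i) (N m).input ((N m).effect j)).re)
    (fun k m i j => (hΦ.pairing_eq_re _ _ _ _).1)
    (by
      intro k m
      rw [Finset.sum_comm]
      simp only [← Complex.re_sum, hB, ← Matrix.trace_sum, ← condChannel_sum_right,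
        (N m).sum_effect]
      rw [hΦ.trace_condChannel_one (N m).input_trace, trace_trSnd, (M k).input_trace,
        Complex.one_re])
    (by
      intro k i
      simp only [← Complex.re_sum, hA]
      rw [hΦ.swapChannel.trace_condChannel_eq (Y := trSnd (N 1).input)]
      simp [trace_trSnd, ChannelMeasurement.input_trace])
    (by
      intro m j
      simp only [← Complex.re_sum, hB]
      rw [hΦ.trace_condChannel_eq (Y := trSnd (M 1).input)]
      simp [trace_trSnd, ChannelMeasurement.input_trace])
    hc
  refine ⟨s, fun k m i j => ?_⟩
  rw [(hΦ.pairing_eq_re (M k) (N m) i j).2, hs]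
  split_ifs <;> simp

/-- The channel and the measurements after elimination of the ancillas. -/
theorem IsPRChannelWith.exists_reduced {Φ : TwoQubitOp →ₗ[ℂ] TwoQubitOp}
    {A A' B B' : ChannelMeasurement} (h : IsPRChannelWith Φ A A' B B') :
    ∃ (a b : Fin 2 → Fin 2 → ℂ) (f g : Fin 2 → Fin 2 → Fin 2 → ℂ) (s : Fin 2),
      IsONB a ∧ IsONB b ∧ (∀ k, IsONB (f k)) ∧ (∀ m, IsONB (g m)) ∧
      (trSnd A.input = ketbra (a 0) (a 0) ∧ trSnd A'.input = ketbra (a 1) (a 1) ∧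
        trSnd B.input = ketbra (b 0) (b 0) ∧ trSnd B'.input = ketbra (b 1) (b 1)) ∧
      ∀ k m i j, (Φ (ketbra (a k) (a k) ⊗ₖ ketbra (b m) (b m)) *
        (ketbra (f k i) (f k i) ⊗ₖ ketbra (g m j) (g m j))).trace =
          if i + j = s + k * m then 1 / 2 else 0 := by
  have hΦ := h.nonSignaling.isNonSignalingKraus
  obtain ⟨s, hs⟩ := h.exists_pairing_eq
  generalize hM : ![A, A'] = M at hs
  generalize hN : ![B, B'] = N at hs
  obtain rfl : M 0 = A := by rw [← hM]; rfl
  obtain rfl : M 1 = A' := by rw [← hM]; rfl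
  obtain rfl : N 0 = B := by rw [← hN]; rfl
  obtain rfl : N 1 = B' := by rw [← hN]; rfl
  -- This odd parity is the property of the PR box that drives all later contradictions.
  have hodd : ∀ s : Fin 2, s + 0 * 0 + (s + 0 * 1) + (s + 1 * 0) + (s + 1 * 1) = 1 := by decide
  have key : ∀ {Φ : TwoQubitOp →ₗ[ℂ] TwoQubitOp}, IsNonSignalingKraus Φ →
      ∀ M N : Fin 2 → ChannelMeasurement, (∀ k m i j, pairing Φ (M k).input ((M k).effect i)
        (N m).input ((N m).effect j) = if i + j = s + k * m then 1 / 2 else 0) →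
      ∃ (a : Fin 2 → Fin 2 → ℂ) (f : Fin 2 → Fin 2 → Fin 2 → ℂ), IsONB a ∧ (∀ k, IsONB (f k)) ∧
        (∀ k, trSnd (M k).input = ketbra (a k) (a k)) ∧
        (∀ k p p', ancSlice (M k).input p p' = trFst (M k).input p p' • ketbra (a k) (a k)) ∧
        ∀ k i, reducedEffect (trFst (M k).input) ((M k).effect i) = ketbra (f k i) (f k i) := by
    intro Φ hΦ M N hs
    have hsum : ∀ m, ∑ j, condChannel Φ (N m).input ((N m).effect j) =
        condChannel Φ (N m).input 1 := by
      intro m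
      refine LinearMap.ext fun X => ?_
      rw [LinearMap.sum_apply, ← condChannel_sum_right, (N m).sum_effect]
    refine exists_reduced_measurement (fun k => (M k).input_pos) (fun k => (M k).input_trace)
      (fun k i => (M k).posSemidef_effect i) (fun k => (M k).sum_effect)
      (T := fun m j => condChannel Φ (N m).input ((N m).effect j))
      (fun m j => condChannel_hasKraus hΦ.hasKraus (N m).input_pos ((N m).posSemidef_effect j))
      ?_ ?_ (t := fun k m => s + k * m) ?_ ?_
    · rw [hsum, hsum, hΦ.condChannel_one_eq (N 0).input_trace (N 1).input_trace]
    · intro X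
      rw [hsum, hΦ.trace_condChannel_one (N 0).input_trace]
    · exact hodd s
    · intro k m i j
      rw [trace_ampl_condChannel, hs]
  obtain ⟨a, f, ha, hf, ha', hρ, hF⟩ := key hΦ M N hs
  obtain ⟨b, g, hb, hg, hb', hσ, hG⟩ := key hΦ.swapChannel N M (by
    intro k m i j
    rw [pairing_swapChannel, hs, add_comm j, mul_comm m])
  refine ⟨a, b, f, g, s, ha, hb, hf, hg, ⟨ha' 0, ha' 1, hb' 0, hb' 1⟩, fun k m i j => ?_⟩
  rw [← hF, ← hG, ← pairing_of_ancSlice Φ (hρ k) (hσ m), hs]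

/-! ### Relative position of two bases -/

/-- In dimension two, `f' j ⊥ f i` puts `f' j` on the line of `f (i + 1)`, and the complementary
lines then agree as well. The shift `i + 1 + j` takes `j` to `i + 1`. -/
theorem IsONB.ketbra_eq_of_dotProduct_eq_zero {f f' : Fin 2 → Fin 2 → ℂ} (hf : IsONB f)
    (hf' : IsONB f') {i j : Fin 2} (h : star (f i) ⬝ᵥ f' j = 0) (l : Fin 2) :
    ketbra (f' l) (f' l) = ketbra (f (l + (i + 1 + j))) (f (l + (i + 1 + j))) := by
  have h1 : ketbra (f' j) (f' j) = ketbra (f (i + 1)) (f (i + 1)) := by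
    have he := hf.comp (Equiv.addRight (i + 1))
    have h2 : (1 : Fin 2) + (i + 1) = i := (by decide : ∀ i : Fin 2, 1 + (i + 1) = i) i
    have := he.eq_ketbra (H := ketbra (f' j) (f' j)) (conjTranspose_ketbra _ _)
      (by
        rw [ketbra_mulVec, Matrix.star_dotProduct]
        simp only [Equiv.coe_addRight, h2, h, star_zero, zero_smul])
    rw [trace_ketbra, star_dotProduct_self_of_isONB hf', one_smul] at this
    simpa only [Equiv.coe_addRight, zero_add] using this
  have h3 := hf.sum_ketbra
  have h4 := hf'.sum_ketbra
  rw [Fin.sum_univ_two] at h3 h4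
  have h5 : ketbra (f' (j + 1)) (f' (j + 1)) = ketbra (f i) (f i) := by
    have h3' : ketbra (f i) (f i) = 1 - ketbra (f (i + 1)) (f (i + 1)) := by
      rw [← h3]
      fin_cases i <;> simp
    have h4' : ketbra (f' (j + 1)) (f' (j + 1)) = 1 - ketbra (f' j) (f' j) := by
      rw [← h4]
      fin_cases j <;> simp
    rw [h3', h4', h1]
  have hl : l = j ∨ l = j + 1 := 
    (by decide : ∀ l j : Fin 2, l = j ∨ l = j + 1) l j
  rcases hl with rfl | rfl
  · rw [h1, (by decide : ∀ l i : Fin 2, l + (i + 1 + l) = i + 1) l i]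
  · rw [h5, (by decide : ∀ j i : Fin 2, j + 1 + (i + 1 + j) = i) j i]

/-- Only the projections of an output basis enter the statistics, so phases and labels may be
changed. Bases sharing a line can therefore be made literally equal, at the cost of a relabelling
`u`. -/
theorem IsONB.exists_aligned {f f' : Fin 2 → Fin 2 → ℂ} (hf : IsONB f) (hf' : IsONB f') :
    ∃ (f'' : Fin 2 → Fin 2 → ℂ) (u : Fin 2), IsONB f'' ∧
      (∀ l, ketbra (f' l) (f' l) = ketbra (f'' (l + u)) (f'' (l + u))) ∧
      (f = f'' ∨ ∀ i j, star (f i) ⬝ᵥ f'' j ≠ 0) := by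
  by_cases h : ∃ i j, star (f i) ⬝ᵥ f' j = 0
  · obtain ⟨i, j, hij⟩ := h
    exact ⟨f, _, hf, hf.ketbra_eq_of_dotProduct_eq_zero hf' hij, Or.inl rfl⟩
  · exact ⟨f', 0, hf', by simp, Or.inr (by simpa using h)⟩

theorem exists_aligned_family {f : Fin 2 → Fin 2 → Fin 2 → ℂ} (hf : ∀ k, IsONB (f k)) :
    ∃ (F : Fin 2 → Fin 2 → Fin 2 → ℂ) (u : Fin 2 → Fin 2), (∀ k, IsONB (F k)) ∧
      (∀ k i, ketbra (F k i) (F k i) = ketbra (f k (i + u k)) (f k (i + u k))) ∧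
      ((∀ k k', F k = F k') ∨ ∀ k k', k ≠ k' → ∀ i j, star (F k i) ⬝ᵥ F k' j ≠ 0) := by
  obtain ⟨f'', u, h1, h2, h3⟩ := (hf 0).exists_aligned (hf 1)
  refine ⟨![f 0, f''], ![0, u], ?_, ?_, ?_⟩
  · rw [Fin.forall_fin_two]
    exact ⟨hf 0, h1⟩
  · rw [Fin.forall_fin_two]
    refine ⟨by simp, fun i => ?_⟩
    simp only [Matrix.cons_val_one, Matrix.cons_val_zero]
    rw [h2, (by decide : ∀ i u : Fin 2, i + u + u = i) i u]
  · rcases h3 with h3 | h3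
    · left
      simp [Fin.forall_fin_two, h3]
    · right
      have h4 : ∀ i j, star (f'' i) ⬝ᵥ f 0 j ≠ 0 := by
        intro i j
        rw [Matrix.star_dotProduct]
        exact star_ne_zero.mpr (h3 j i)
      intro k k' hk
      fin_cases k <;> fin_cases k'
      · exact absurd rfl hk
      · exact h3
      · exact h4
      · exact absurd rfl hk

/-! ### Product vectors -/

/-- `v ⊗ w`. -/
def tensorVec (v w : Fin 2 → ℂ) : Fin 2 × Fin 2 → ℂ := fun x => v x.1 * w x.2

theorem star_tensorVec_dotProduct (v w v' w' : Fin 2 → ℂ) :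
    star (tensorVec v w) ⬝ᵥ tensorVec v' w' = (star v ⬝ᵥ v') * (star w ⬝ᵥ w') := by
  simp only [dotProduct, tensorVec, Fintype.sum_prod_type, Fin.sum_univ_two, Pi.star_apply,
    star_mul']
  ring

theorem ketbra_tensorVec (v w v' w' : Fin 2 → ℂ) :
    ketbra (tensorVec v w) (tensorVec v' w') = ketbra v v' ⊗ₖ ketbra w w' := by
  ext i j
  simp only [ketbra_apply, tensorVec, Matrix.kroneckerMap_apply, star_mul']
  ring

theorem trFst_ketbra_tensorVec (v w v' w' : Fin 2 → ℂ) :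
    trFst (ketbra (tensorVec v w) (tensorVec v' w')) = (star v' ⬝ᵥ v) • ketbra w w' := by
  rw [ketbra_tensorVec, trFst_kronecker, trace_ketbra]

theorem trSnd_ketbra_tensorVec (v w v' w' : Fin 2 → ℂ) :
    trSnd (ketbra (tensorVec v w) (tensorVec v' w')) = (star w' ⬝ᵥ w) • ketbra v v' := by
  rw [ketbra_tensorVec, trSnd_kronecker, trace_ketbra]

theorem IsONB.sum_ketbra_tensorVec {f g : Fin 2 → Fin 2 → ℂ} (hf : IsONB f) (hg : IsONB g) :
    ∑ i, ∑ j, ketbra (tensorVec (f i) (g j)) (tensorVec (f i) (g j)) = 1 := by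
  rw [← Matrix.one_kronecker_one (α := ℂ) (m := Fin 2) (n := Fin 2)]
  nth_rw 1 [← hf.sum_ketbra]
  rw [← hg.sum_ketbra]
  simp only [ketbra_tensorVec, Fin.sum_univ_two, Matrix.add_kronecker, Matrix.kronecker_add]
  abel

/-! ### Normal form of the channel on pairs of input basis vectors -/

/-- The data obtained from a PR-channel: input bases `a`, `b`, output bases `f k`, `g m` which are
either equal or have no orthogonal vectors for different inputs, and the correlations `t`. -/
structure IsPRData (Φ : TwoQubitOp →ₗ[ℂ] TwoQubitOp) (a b : Fin 2 → Fin 2 → ℂ)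
    (f g : Fin 2 → Fin 2 → Fin 2 → ℂ) (t : Fin 2 × Fin 2 → Fin 2) : Prop where
  nonSignaling : IsNonSignalingKraus Φ
  onb_a : IsONB a
  onb_b : IsONB b
  onb_f : ∀ k, IsONB (f k)
  onb_g : ∀ m, IsONB (g m)
  aligned_f : (∀ k k', f k = f k') ∨ ∀ k k', k ≠ k' → ∀ i j, star (f k i) ⬝ᵥ f k' j ≠ 0
  aligned_g : (∀ m m', g m = g m') ∨ ∀ m m', m ≠ m' → ∀ i j, star (g m i) ⬝ᵥ g m' j ≠ 0
  odd : t (0, 0) + t (0, 1) + t (1, 0) + t (1, 1) = 1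
  trace_eq : ∀ α i j, (Φ (ketbra (tensorVec (a α.1) (b α.2)) (tensorVec (a α.1) (b α.2))) *
    ketbra (tensorVec (f α.1 i) (g α.2 j)) (tensorVec (f α.1 i) (g α.2 j))).trace =
      if j = i + t α then 1 / 2 else 0

theorem IsPRChannelWith.exists_isPRData {Φ : TwoQubitOp →ₗ[ℂ] TwoQubitOp}
    {A A' B B' : ChannelMeasurement} (h : IsPRChannelWith Φ A A' B B') :
    ∃ a b f g t, IsPRData Φ a b f g t ∧
      (trSnd A.input = ketbra (a 0) (a 0) ∧ trSnd A'.input = ketbra (a 1) (a 1) ∧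
        trSnd B.input = ketbra (b 0) (b 0) ∧ trSnd B'.input = ketbra (b 1) (b 1)) := by
  obtain ⟨a, b, f, g, s, ha, hb, hf, hg, hab, h1⟩ := h.exists_reduced
  obtain ⟨F, u, hF, hFf, hF'⟩ := exists_aligned_family hf
  obtain ⟨G, v, hG, hGg, hG'⟩ := exists_aligned_family hg
  -- Each relabelling shift enters the sum over the four inputs twice, so the sum of the
  -- correlations stays odd.
  refine ⟨a, b, F, G, fun α => s + α.1 * α.2 + u α.1 + v α.2,
    ⟨h.nonSignaling.isNonSignalingKraus, ha, hb, hF, hG, hF', hG', ?_, ?_⟩, hab⟩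
  · dsimp only
    generalize u 0 = u0
    generalize u 1 = u1
    generalize v 0 = v0
    generalize v 1 = v1
    clear h1
    revert s u0 u1 v0 v1
    decide
  · rintro ⟨k, m⟩ i j
    simp only [ketbra_tensorVec, hFf, hGg, h1]
    congr 1
    generalize u k = x
    generalize v m = y
    clear h1
    simp only [eq_iff_iff]
    revert s k m i j x y
    decide

namespace IsPRData

variable {Φ : TwoQubitOp →ₗ[ℂ] TwoQubitOp} {a b : Fin 2 → Fin 2 → ℂ}
  {f g : Fin 2 → Fin 2 → Fin 2 → ℂ} {t : Fin 2 × Fin 2 → Fin 2}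

/-- The input basis. -/
def inVec (a b : Fin 2 → Fin 2 → ℂ) (α : Fin 2 × Fin 2) : Fin 2 × Fin 2 → ℂ :=
  tensorVec (a α.1) (b α.2)

/-- The output vectors `f_i ⊗ g_{i + t}` for the input `α`. -/
def outVec (f g : Fin 2 → Fin 2 → Fin 2 → ℂ) (t : Fin 2 × Fin 2 → Fin 2) (α : Fin 2 × Fin 2)
    (i : Fin 2) : Fin 2 × Fin 2 → ℂ :=
  tensorVec (f α.1 i) (g α.2 (i + t α))

theorem star_inVec_dotProduct (h : IsPRData Φ a b f g t) (α β : Fin 2 × Fin 2) :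
    star (inVec a b α) ⬝ᵥ inVec a b β = if α = β then 1 else 0 := by
  rw [inVec, inVec, star_tensorVec_dotProduct, h.onb_a, h.onb_b]
  simp only [Prod.ext_iff, ite_and, ite_mul, one_mul, zero_mul]

theorem star_outVec_dotProduct (h : IsPRData Φ a b f g t) (α : Fin 2 × Fin 2) (i j : Fin 2) :
    star (outVec f g t α i) ⬝ᵥ outVec f g t α j = if i = j then 1 else 0 := by
  rw [outVec, outVec, star_tensorVec_dotProduct, h.onb_f, h.onb_g]
  simp

theorem ketbra_mul_ketbra {ι : Type} [Fintype ι] (u v w x : ι → ℂ) :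
    ketbra u v * ketbra w x = (star v ⬝ᵥ w) • ketbra u x := by
  rw [mul_ketbra, ketbra_mulVec]
  ext i j
  simp [ketbra_apply, mul_assoc]

/-- Since `|α⟩⟨β| = |α⟩⟨α| |α⟩⟨β|`, an outcome forbidden for the input `α` also kills the coherences
of `α` from the left. -/
theorem ketbra_mul_apply_eq_zero (h : IsPRData Φ a b f g t) (α β : Fin 2 × Fin 2) {i j : Fin 2}
    (hij : j ≠ i + t α) :
    ketbra (tensorVec (f α.1 i) (g α.2 j)) (tensorVec (f α.1 i) (g α.2 j)) *
      Φ (ketbra (inVec a b α) (inVec a b β)) = 0 := by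
  have h1 := h.trace_eq α i j
  rw [if_neg hij] at h1
  obtain ⟨J, _, K, hK⟩ := h.nonSignaling.hasKraus
  rw [hK] at h1
  have h2 : ketbra (inVec a b α) (inVec a b β) =
      ketbra (inVec a b α) (inVec a b α) * ketbra (inVec a b α) (inVec a b β) := by
    rw [ketbra_mul_ketbra, h.star_inVec_dotProduct, if_pos rfl, one_smul]
  rw [hK, Matrix.mul_sum]
  refine Finset.sum_eq_zero fun l _ => ?_
  have h3 := mul_kraus_mul_eq_zero K (Matrix.posSemidef_vecMulVec_self_star _)
    (Matrix.posSemidef_vecMulVec_self_star _) h1 l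
  rw [h2, ← Matrix.mul_assoc, ← Matrix.mul_assoc, ← Matrix.mul_assoc]
  erw [h3]
  simp

theorem conjTranspose_apply (h : IsPRData Φ a b f g t) (X : TwoQubitOp) : (Φ X)ᴴ = Φ Xᴴ := by
  obtain ⟨J, _, K, hK⟩ := h.nonSignaling.hasKraus
  simp [hK, Matrix.conjTranspose_sum, Matrix.conjTranspose_mul, Matrix.mul_assoc]

/-- The coefficients of `Φ(|α⟩⟨β|)` with respect to the output vectors. -/
noncomputable def coeff (Φ : TwoQubitOp →ₗ[ℂ] TwoQubitOp) (a b : Fin 2 → Fin 2 → ℂ)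
    (f g : Fin 2 → Fin 2 → Fin 2 → ℂ) (t : Fin 2 × Fin 2 → Fin 2) (α β : Fin 2 × Fin 2)
    (i j : Fin 2) : ℂ :=
  star (outVec f g t α i) ⬝ᵥ (Φ (ketbra (inVec a b α) (inVec a b β)) *ᵥ outVec f g t β j)

theorem sum_ketbra_outVec_mul (h : IsPRData Φ a b f g t) (α β : Fin 2 × Fin 2) :
    (∑ i, ketbra (outVec f g t α i) (outVec f g t α i)) *
      Φ (ketbra (inVec a b α) (inVec a b β)) = Φ (ketbra (inVec a b α) (inVec a b β)) := by
  conv_rhs => rw [← Matrix.one_mul (Φ _),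
    ← (h.onb_f α.1).sum_ketbra_tensorVec (h.onb_g α.2), Matrix.sum_mul]
  rw [Matrix.sum_mul]
  refine Finset.sum_congr rfl fun i _ => ?_
  rw [Matrix.sum_mul, Finset.sum_eq_single (i + t α)]
  · rfl
  · intro j _ hj
    exact h.ketbra_mul_apply_eq_zero α β hj
  · simp

theorem apply_ketbra (h : IsPRData Φ a b f g t) (α β : Fin 2 × Fin 2) :
    Φ (ketbra (inVec a b α) (inVec a b β)) = ∑ i, ∑ j, coeff Φ a b f g t α β i j •
      ketbra (outVec f g t α i) (outVec f g t β j) := by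
  have h1 := h.sum_ketbra_outVec_mul α β
  have h2 := congrArg Matrix.conjTranspose (h.sum_ketbra_outVec_mul β α)
  rw [Matrix.conjTranspose_mul, h.conjTranspose_apply, conjTranspose_ketbra,
    Matrix.conjTranspose_sum] at h2
  simp only [conjTranspose_ketbra] at h2
  rw [← h2, ← h1]
  simp only [Matrix.sum_mul, Matrix.mul_sum]
  rw [Finset.sum_comm]
  refine Finset.sum_congr rfl fun i _ => Finset.sum_congr rfl fun j _ => ?_
  rw [mul_ketbra, ← Matrix.mulVec_mulVec, ketbra_mulVec, coeff]
  ext x y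
  simp [ketbra_apply, mul_assoc]

end IsPRData

/-! ### Constraints of non-signaling on the coefficients -/

theorem trFst_add (X Y : TwoQubitOp) : trFst (X + Y) = trFst X + trFst Y := by
  ext i j
  simp only [trFst, Matrix.of_apply, Matrix.add_apply, Finset.sum_add_distrib]

theorem trSnd_add (X Y : TwoQubitOp) : trSnd (X + Y) = trSnd X + trSnd Y := by
  ext i j
  simp only [trSnd, Matrix.of_apply, Matrix.add_apply, Finset.sum_add_distrib]

theorem trFst_smul (c : ℂ) (X : TwoQubitOp) : trFst (c • X) = c • trFst X := by
  ext i j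
  simp only [trFst, Matrix.of_apply, Matrix.smul_apply, Finset.smul_sum]

theorem trSnd_smul (c : ℂ) (X : TwoQubitOp) : trSnd (c • X) = c • trSnd X := by
  ext i j
  simp only [trSnd, Matrix.of_apply, Matrix.smul_apply, Finset.smul_sum]

theorem IsNonSignalingKraus.trFst_eq_zero {Φ : TwoQubitOp →ₗ[ℂ] TwoQubitOp}
    (h : IsNonSignalingKraus Φ) {X : TwoQubitOp} (hX : trFst X = 0) : trFst (Φ X) = 0 := by
  have h0 : trFst (0 : TwoQubitOp) = 0 := by
    ext i j
    simp [trFst]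
  rw [h.trFst_eq X 0 (hX.trans h0.symm), map_zero, h0]

theorem IsNonSignalingKraus.trSnd_eq_zero {Φ : TwoQubitOp →ₗ[ℂ] TwoQubitOp}
    (h : IsNonSignalingKraus Φ) {X : TwoQubitOp} (hX : trSnd X = 0) : trSnd (Φ X) = 0 := by
  have h0 : trSnd (0 : TwoQubitOp) = 0 := by
    ext i j
    simp [trSnd]
  rw [h.trSnd_eq X 0 (hX.trans h0.symm), map_zero, h0]

theorem IsONB.dotProduct_sum_ketbra_mulVec {f f' : Fin 2 → Fin 2 → ℂ} (hf : IsONB f)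
    (hf' : IsONB f') (c : Fin 2 → Fin 2 → ℂ) (u v i j : Fin 2) :
    star (f (i + u)) ⬝ᵥ ((∑ x, ∑ y, c x y • ketbra (f (x + u)) (f' (y + v))) *ᵥ f' (j + v)) =
      c i j := by
  simp only [Matrix.sum_mulVec, Matrix.smul_mulVec, ketbra_mulVec, dotProduct_sum,
    dotProduct_smul, hf _ _, hf' _ _, add_left_inj, smul_eq_mul]
  simp

namespace IsPRData

variable {Φ : TwoQubitOp →ₗ[ℂ] TwoQubitOp} {a b : Fin 2 → Fin 2 → ℂ}
  {f g : Fin 2 → Fin 2 → Fin 2 → ℂ} {t : Fin 2 × Fin 2 → Fin 2}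

/-- Tracing out Alice turns her vectors into their overlap. As `i + t α` determines `i`, distinct
coefficients contribute to distinct matrix elements of Bob's marginal. -/
theorem coeff_mul_left (h : IsPRData Φ a b f g t) (α β : Fin 2 × Fin 2) (i j : Fin 2) :
    coeff Φ a b f g t α β i j * (star (f β.1 j) ⬝ᵥ f α.1 i) =
      star (g α.2 (i + t α)) ⬝ᵥ
        (trFst (Φ (ketbra (inVec a b α) (inVec a b β))) *ᵥ g β.2 (j + t β)) := by
  rw [h.apply_ketbra]
  have := (h.onb_g α.2).dotProduct_sum_ketbra_mulVec (h.onb_g β.2)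
    (fun x y => coeff Φ a b f g t α β x y * (star (f β.1 y) ⬝ᵥ f α.1 x)) (t α) (t β) i j
  simp only [← this, Fin.sum_univ_two, trFst_add, trFst_smul, outVec, trFst_ketbra_tensorVec,
    smul_smul]

theorem coeff_mul_right (h : IsPRData Φ a b f g t) (α β : Fin 2 × Fin 2) (i j : Fin 2) :
    coeff Φ a b f g t α β i j * (star (g β.2 (j + t β)) ⬝ᵥ g α.2 (i + t α)) =
      star (f α.1 i) ⬝ᵥ
        (trSnd (Φ (ketbra (inVec a b α) (inVec a b β))) *ᵥ f β.1 j) := by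
  rw [h.apply_ketbra]
  have := (h.onb_f α.1).dotProduct_sum_ketbra_mulVec (h.onb_f β.1)
    (fun x y => coeff Φ a b f g t α β x y * (star (g β.2 (y + t β)) ⬝ᵥ g α.2 (x + t α))) 0 0 i j
  simp only [add_zero] at this
  simp only [← this, Fin.sum_univ_two, trSnd_add, trSnd_smul, outVec, trSnd_ketbra_tensorVec,
    smul_smul]

/-- Orthogonality of Alice's inputs gives `|α⟩⟨β|` zero marginal on Bob's side, so the output has
zero marginal there too. -/
theorem coeff_mul_left_eq_zero (h : IsPRData Φ a b f g t) {α β : Fin 2 × Fin 2} (hαβ : α.1 ≠ β.1)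
    (i j : Fin 2) : coeff Φ a b f g t α β i j * (star (f β.1 j) ⬝ᵥ f α.1 i) = 0 := by
  rw [h.coeff_mul_left, h.nonSignaling.trFst_eq_zero]
  · simp
  · rw [inVec, inVec, trFst_ketbra_tensorVec, h.onb_a, if_neg hαβ.symm, zero_smul]

theorem coeff_mul_right_eq_zero (h : IsPRData Φ a b f g t) {α β : Fin 2 × Fin 2}
    (hαβ : α.2 ≠ β.2) (i j : Fin 2) :
    coeff Φ a b f g t α β i j * (star (g β.2 (j + t β)) ⬝ᵥ g α.2 (i + t α)) = 0 := by
  rw [h.coeff_mul_right, h.nonSignaling.trSnd_eq_zero]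
  · simp
  · rw [inVec, inVec, trSnd_ketbra_tensorVec, h.onb_b, if_neg hαβ.symm, zero_smul]

theorem aligned_left_of_coeff_ne_zero (h : IsPRData Φ a b f g t) {α β : Fin 2 × Fin 2}
    (hαβ : α.1 ≠ β.1) {i j : Fin 2} (hc : coeff Φ a b f g t α β i j ≠ 0) :
    (∀ k k', f k = f k') ∧ i ≠ j := by
  have h1 := (mul_eq_zero.mp (h.coeff_mul_left_eq_zero hαβ i j)).resolve_left hc
  rcases h.aligned_f with h2 | h2
  · refine ⟨h2, ?_⟩
    rintro rfl
    rw [h2 β.1 α.1, h.onb_f] at h1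
    simp at h1
  · exact absurd h1 (h2 _ _ hαβ.symm _ _)

theorem aligned_right_of_coeff_ne_zero (h : IsPRData Φ a b f g t) {α β : Fin 2 × Fin 2}
    (hαβ : α.2 ≠ β.2) {i j : Fin 2} (hc : coeff Φ a b f g t α β i j ≠ 0) :
    (∀ m m', g m = g m') ∧ i + t α ≠ j + t β := by
  have h1 := (mul_eq_zero.mp (h.coeff_mul_right_eq_zero hαβ i j)).resolve_left hc
  rcases h.aligned_g with h2 | h2
  · refine ⟨h2, fun h3 => ?_⟩
    rw [h2 β.2 α.2, h.onb_g, if_pos h3.symm] at h1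
    simp at h1
  · exact absurd h1 (h2 _ _ hαβ.symm _ _)

/-- Bob's choice of a different basis vector does not change Alice's marginal. -/
theorem add_eq_add_of_coeff_ne_zero (h : IsPRData Φ a b f g t) (k k' m m' : Fin 2)
    {i j : Fin 2} (hc : coeff Φ a b f g t (k, m) (k', m) i j ≠ 0)
    (hij : i + t (k, m) = j + t (k', m)) : i + t (k, m') = j + t (k', m') := by
  have h1 := h.coeff_mul_right (k, m) (k', m) i j
  have h2 := h.coeff_mul_right (k, m') (k', m') i j
  rw [h.nonSignaling.trSnd_eq _ (ketbra (inVec a b (k, m')) (inVec a b (k', m'))), ← h2] at h1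
  · dsimp only at h1
    rw [hij, h.onb_g, if_pos rfl, mul_one, h.onb_g] at h1
    by_contra h3
    rw [if_neg (Ne.symm h3), mul_zero] at h1
    exact hc h1
  · simp only [inVec, trSnd_ketbra_tensorVec, star_dotProduct_self_of_isONB h.onb_b]

/-- Alice's choice of a different basis vector does not change Bob's marginal. -/
theorem add_add_eq_of_coeff_ne_zero (h : IsPRData Φ a b f g t) (k k' m m' : Fin 2)
    {i : Fin 2} (hc : coeff Φ a b f g t (k, m) (k, m') i i ≠ 0) :
    t (k, m) + t (k', m) = t (k, m') + t (k', m') := by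
  have h1 := h.coeff_mul_left (k, m) (k, m') i i
  -- Alice's indices for `k'` are chosen so that Bob's indices, and hence the matrix element of his
  -- marginal, are those of `h1`.
  have h2 := h.coeff_mul_left (k', m) (k', m') (i + t (k, m) + t (k', m))
    (i + t (k, m') + t (k', m'))
  have h4 : ∀ x y : Fin 2, x + y + y = x := by decide
  simp only [h4] at h2
  rw [h.nonSignaling.trFst_eq _ (ketbra (inVec a b (k', m)) (inVec a b (k', m'))), ← h2] at h1
  · dsimp only at h1
    rw [h.onb_f, if_pos rfl, mul_one, h.onb_f] at h1
    by_contra h3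
    rw [if_neg, mul_zero] at h1
    · exact hc h1
    · rw [add_assoc, add_assoc, add_right_inj]
      exact Ne.symm h3
  · simp only [inVec, trFst_ketbra_tensorVec, star_dotProduct_self_of_isONB h.onb_a]

theorem add_ne_add (h : IsPRData Φ a b f g t) {k k' m m' : Fin 2} (hk : k ≠ k') (hm : m ≠ m') :
    t (k, m) + t (k', m) ≠ t (k, m') + t (k', m') := by
  have key : ∀ x y z w : Fin 2, x + y + z + w = 1 →
      x + z ≠ y + w ∧ z + x ≠ w + y ∧ y + w ≠ x + z ∧ w + y ≠ z + x := by decide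
  obtain ⟨h1, h2, h3, h4⟩ := key _ _ _ _ h.odd
  fin_cases k <;> fin_cases k' <;> fin_cases m <;> fin_cases m' <;>
    first | exact absurd rfl hk | exact absurd rfl hm | assumption

/-- A party whose inputs differ must have equal output bases and different output indices. If a
party's inputs agree, changing that common input leaves the other party's marginal unchanged; equal
indices for that party would then contradict the odd parity. So both index pairs differ, which
forces `t α = t β`. -/
theorem of_coeff_ne_zero (h : IsPRData Φ a b f g t) {α β : Fin 2 × Fin 2} (hαβ : α ≠ β)
    {i j : Fin 2} (hc : coeff Φ a b f g t α β i j ≠ 0) :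
    t α = t β ∧ i ≠ j ∧ (α.1 ≠ β.1 → ∀ k k', f k = f k') ∧
      (α.2 ≠ β.2 → ∀ m m', g m = g m') := by
  obtain ⟨k, m⟩ := α
  obtain ⟨k', m'⟩ := β
  have hsucc : ∀ x : Fin 2, x ≠ x + 1 := by decide
  have hij : i ≠ j := by
    by_cases hk : k = k'
    · subst hk
      have hm : m ≠ m' := fun hm => hαβ (by rw [hm])
      rintro rfl
      exact h.add_ne_add (hsucc k) hm (h.add_add_eq_of_coeff_ne_zero k (k + 1) m m' hc)
    · exact (h.aligned_left_of_coeff_ne_zero hk hc).2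
  refine ⟨?_, hij, fun h1 => (h.aligned_left_of_coeff_ne_zero h1 hc).1,
    fun h1 => (h.aligned_right_of_coeff_ne_zero h1 hc).1⟩
  by_contra ht
  have hadd : i + t (k, m) = j + t (k', m') :=
    (by decide : ∀ i j x y : Fin 2, i ≠ j → x ≠ y → i + x = j + y) _ _ _ _ hij ht
  by_cases hm : m = m'
  · subst hm
    have hk : k ≠ k' := fun hk => hαβ (by rw [hk])
    have h1 := h.add_eq_add_of_coeff_ne_zero k k' m (m + 1) hc hadd
    refine h.add_ne_add hk (hsucc m) ?_
    exact (by decide : ∀ i j x y z w : Fin 2, i + x = j + y → i + z = j + w → x + y = z + w)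
      _ _ _ _ _ _ hadd h1
  · exact (h.aligned_right_of_coeff_ne_zero hm hc).2 hadd

end IsPRData

/-! ### Assembly of the Choi matrix -/

theorem IsONB.exists_orthonormalBasis {a : Fin 2 → Fin 2 → ℂ} (ha : IsONB a) :
    ∃ A : QubitBasis, ∀ k, (A k).ofLp = a k := by
  have hon : Orthonormal ℂ fun k => WithLp.toLp 2 (a k) := by
    rw [orthonormal_iff_ite]
    intro i j
    rw [EuclideanSpace.inner_eq_star_dotProduct, dotProduct_comm]
    exact ha i j
  let B := basisOfOrthonormalOfCardEqFinrank hon (by simp)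
  have hB : ⇑B = fun k => WithLp.toLp 2 (a k) := coe_basisOfOrthonormalOfCardEqFinrank _ _
  refine ⟨B.toOrthonormalBasis (by rwa [hB]), fun k => ?_⟩
  rw [Module.Basis.coe_toOrthonormalBasis, hB]

theorem mul_mul_conjTranspose_eq_sum {m n n' : Type} [Fintype n] [Fintype n']
    (U : Matrix m n ℂ) (X : Matrix n n' ℂ) (V : Matrix m n' ℂ) :
    U * X * Vᴴ = ∑ i, ∑ j, X i j • ketbra (U.col i) (V.col j) := by
  ext x y
  simp only [Matrix.mul_apply, Matrix.sum_apply, Matrix.smul_apply, ketbra_apply, Matrix.col_apply,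
    Matrix.conjTranspose_apply, Finset.sum_mul, smul_eq_mul]
  rw [Finset.sum_comm]
  refine Finset.sum_congr rfl fun i _ => Finset.sum_congr rfl fun j _ => ?_
  ring

theorem kronecker_mul_single_mul {m n : Type} [Fintype m] [DecidableEq m] [Fintype n]
    [DecidableEq n] {M N : Type} (V : Matrix M m ℂ) (W : Matrix N n ℂ)
    (X : Matrix m m ℂ) (p q : n) :
    (V ⊗ₖ W) * (X ⊗ₖ Matrix.single p q (1 : ℂ)) * (Vᴴ ⊗ₖ Wᴴ) =
      (V * X * Vᴴ) ⊗ₖ ketbra (W.col p) (W.col q) := by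
  rw [← Matrix.mul_kronecker_mul, ← Matrix.mul_kronecker_mul]
  congr 1
  ext x y
  simp [Matrix.mul_apply, Matrix.single_apply, ketbra_apply, ite_and]

theorem kronecker_mul_Bblock_mul {M N : Type} {r : ℕ} (V : Matrix M (Fin 2) ℂ)
    (W : Matrix N (Fin r) ℂ) (z : Fin r → ℂ) (x y : Fin r → Fin r → ℂ) :
    (V ⊗ₖ W) * Bblock r z x y * (Vᴴ ⊗ₖ Wᴴ) =
      ∑ p, ∑ q, (V * ((1 / 2 : ℂ) • if p = q then Bdiag (z p) else Boff (x p q) (y p q)) * Vᴴ) ⊗ₖ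
        ketbra (W.col p) (W.col q) := by
  have h : Bblock r z x y = ∑ p, ∑ q,
      ((1 / 2 : ℂ) • if p = q then Bdiag (z p) else Boff (x p q) (y p q)) ⊗ₖ
        Matrix.single p q (1 : ℂ) := by
    rw [Bblock, ← Finset.sum_add_distrib, Finset.smul_sum]
    refine Finset.sum_congr rfl fun p _ => ?_
    rw [← Finset.add_sum_erase _ _ (Finset.mem_univ p), if_pos rfl, smul_add,
      Matrix.smul_kronecker, Finset.smul_sum]
    congr 1
    refine Finset.sum_congr (by ext q; simp) fun q hq => ?_
    rw [if_neg (by simpa using (Finset.mem_erase.mp hq).1.symm), Matrix.smul_kronecker]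
  rw [h]
  simp only [Matrix.mul_sum, Matrix.sum_mul, kronecker_mul_single_mul]

namespace IsPRData

variable {Φ : TwoQubitOp →ₗ[ℂ] TwoQubitOp} {a b : Fin 2 → Fin 2 → ℂ}
  {f g : Fin 2 → Fin 2 → Fin 2 → ℂ} {t : Fin 2 × Fin 2 → Fin 2}

theorem star_coeff (h : IsPRData Φ a b f g t) (α β : Fin 2 × Fin 2) (i j : Fin 2) :
    star (coeff Φ a b f g t α β i j) = coeff Φ a b f g t β α j i := by
  rw [coeff, coeff, ← conjTranspose_ketbra, ← h.conjTranspose_apply, ← Matrix.star_dotProduct,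
    Matrix.star_mulVec, Matrix.conjTranspose_conjTranspose, ← Matrix.dotProduct_mulVec]

theorem coeff_self (h : IsPRData Φ a b f g t) (α : Fin 2 × Fin 2) (i : Fin 2) :
    coeff Φ a b f g t α α i i = 1 / 2 := by
  have := h.trace_eq α i (i + t α)
  rwa [if_pos rfl, mul_ketbra, trace_ketbra] at this

/-- The isometry spanned by the output vectors. -/
def outIsometry (f g : Fin 2 → Fin 2 → Fin 2 → ℂ) (t : Fin 2 × Fin 2 → Fin 2)
    (α : Fin 2 × Fin 2) : Matrix (Fin 2 × Fin 2) (Fin 2) ℂ :=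
  Matrix.of fun x i => outVec f g t α i x

theorem outIsometry_isIsometry (h : IsPRData Φ a b f g t) (α : Fin 2 × Fin 2) :
    IsIsometry (outIsometry f g t α) := by
  ext i j
  rw [Matrix.one_apply, ← h.star_outVec_dotProduct α i j]
  rfl

theorem apply_ketbra_eq (h : IsPRData Φ a b f g t) (α β : Fin 2 × Fin 2) :
    Φ (ketbra (inVec a b α) (inVec a b β)) = outIsometry f g t α *
      Matrix.of (coeff Φ a b f g t α β) * (outIsometry f g t β)ᴴ := by
  rw [h.apply_ketbra, mul_mul_conjTranspose_eq_sum]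
  rfl

/-- The coefficients of `Φ(|α⟩⟨α|)` form a positive semidefinite 2×2 matrix with diagonal entries `1
/ 2`; its determinant is nonnegative. -/
theorem norm_coeff_le (h : IsPRData Φ a b f g t) (α : Fin 2 × Fin 2) :
    ‖2 * coeff Φ a b f g t α α 0 1‖ ≤ 1 := by
  have h1 : (Matrix.of (coeff Φ a b f g t α α)).PosSemidef := by
    have := (h.nonSignaling.hasKraus.posSemidef
      (Matrix.posSemidef_vecMulVec_self_star (inVec a b α))).conjTranspose_mul_mul_same
        (outIsometry f g t α)
    convert this using 1
    ext i j
    rw [Matrix.mul_assoc]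
    rfl
  have h2 := h1.det_nonneg
  rw [Matrix.det_fin_two] at h2
  simp only [Matrix.of_apply, h.coeff_self, ← h.star_coeff α α 0 1] at h2
  generalize coeff Φ a b f g t α α 0 1 = c at *
  rw [Complex.star_def, Complex.mul_conj, Complex.normSq_eq_norm_sq] at h2
  have h3 : (0 : ℝ) ≤ 1 / 4 - ‖c‖ ^ 2 := by
    have : ((1 / 4 - ‖c‖ ^ 2 : ℝ) : ℂ) = 1 / 2 * (1 / 2) - ((‖c‖ ^ 2 : ℝ) : ℂ) := by
      push_cast
      ring
    rw [← this] at h2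
    exact_mod_cast h2
  rw [norm_mul, Complex.norm_ofNat]
  nlinarith [norm_nonneg c]

theorem of_coeff_self (h : IsPRData Φ a b f g t) (α : Fin 2 × Fin 2) :
    Matrix.of (coeff Φ a b f g t α α) = (1 / 2 : ℂ) • Bdiag (2 * coeff Φ a b f g t α α 0 1) := by
  ext i j
  fin_cases i <;> fin_cases j <;>
    simp [Bdiag, h.coeff_self, ← h.star_coeff α α 0 1]

theorem of_coeff_of_ne (h : IsPRData Φ a b f g t) {α β : Fin 2 × Fin 2} (hαβ : α ≠ β) :
    Matrix.of (coeff Φ a b f g t α β) = (1 / 2 : ℂ) • Boff (2 * coeff Φ a b f g t α β 0 1)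
      (2 * coeff Φ a b f g t α β 1 0) := by
  have h0 : ∀ i, coeff Φ a b f g t α β i i = 0 := by
    intro i
    by_contra hc
    exact (h.of_coeff_ne_zero hαβ hc).2.1 rfl
  ext i j
  fin_cases i <;> fin_cases j <;> simp [Boff, h0]

open scoped Classical in
/-- The inputs whose coherence with some other input is preserved. -/
noncomputable def coherentInputs (Φ : TwoQubitOp →ₗ[ℂ] TwoQubitOp) (a b : Fin 2 → Fin 2 → ℂ)
    (f g : Fin 2 → Fin 2 → Fin 2 → ℂ) (t : Fin 2 × Fin 2 → Fin 2) : Finset (Fin 2 × Fin 2) :=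
  {α | ∃ β, α ≠ β ∧ ∃ i j, coeff Φ a b f g t α β i j ≠ 0}

theorem mem_coherentInputs {α : Fin 2 × Fin 2} : α ∈ coherentInputs Φ a b f g t ↔
    ∃ β, α ≠ β ∧ ∃ i j, coeff Φ a b f g t α β i j ≠ 0 := by
  simp [coherentInputs]

theorem apply_ketbra_eq_zero (h : IsPRData Φ a b f g t) {α β : Fin 2 × Fin 2} (hαβ : α ≠ β)
    (hmem : ¬(α ∈ coherentInputs Φ a b f g t ∧ β ∈ coherentInputs Φ a b f g t)) :
    Φ (ketbra (inVec a b α) (inVec a b β)) = 0 := by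
  have h0 : ∀ i j, coeff Φ a b f g t α β i j = 0 := by
    intro i j
    by_contra hc
    refine hmem ⟨mem_coherentInputs.mpr ⟨β, hαβ, i, j, hc⟩,
      mem_coherentInputs.mpr ⟨α, hαβ.symm, j, i, ?_⟩⟩
    rw [← h.star_coeff]
    exact star_ne_zero.mpr hc
  rw [h.apply_ketbra]
  simp [h0]

/-- The relation `r` below implies equality of output vectors and is transitive, and each coherent
input is related to its partner. It remains to connect two different coherent pairs. -/
theorem outVec_eq_of_mem (h : IsPRData Φ a b f g t) {α β : Fin 2 × Fin 2}
    (hα : α ∈ coherentInputs Φ a b f g t) (hβ : β ∈ coherentInputs Φ a b f g t) :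
    outVec f g t α = outVec f g t β := by
  let r : Fin 2 × Fin 2 → Fin 2 × Fin 2 → Prop := fun α β =>
    t α = t β ∧ (α.1 ≠ β.1 → ∀ k k', f k = f k') ∧ (α.2 ≠ β.2 → ∀ m m', g m = g m')
  have symm : ∀ {α β}, r α β → r β α := fun h =>
    ⟨h.1.symm, fun h1 => h.2.1 h1.symm, fun h1 => h.2.2 h1.symm⟩
  have trans : ∀ {α β γ}, r α β → r β γ → r α γ := by
    intro α β γ h h'
    refine ⟨h.1.trans h'.1, fun h1 => ?_, fun h1 => ?_⟩
    · by_cases h2 : α.1 = β.1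
      · exact h'.2.1 (h2 ▸ h1)
      · exact h.2.1 h2
    · by_cases h2 : α.2 = β.2
      · exact h'.2.2 (h2 ▸ h1)
      · exact h.2.2 h2
  obtain ⟨α', hα', i, j, hc⟩ := mem_coherentInputs.mp hα
  obtain ⟨β', hβ', i', j', hc'⟩ := mem_coherentInputs.mp hβ
  have h1 : r α α' := by
    obtain ⟨h1, _, h3, h4⟩ := h.of_coeff_ne_zero hα' hc
    exact ⟨h1, h3, h4⟩
  have h2 : r β β' := by
    obtain ⟨h1, _, h3, h4⟩ := h.of_coeff_ne_zero hβ' hc'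
    exact ⟨h1, h3, h4⟩
  have h3 : r α β := by
    by_contra h3
    have n1 : α ≠ β := by
      rintro rfl
      exact h3 ⟨rfl, fun h => absurd rfl h, fun h => absurd rfl h⟩
    have n2 : α ≠ β' := by
      rintro rfl
      exact h3 (symm h2)
    have n3 : α' ≠ β := by
      rintro rfl
      exact h3 h1
    have n4 : α' ≠ β' := by
      rintro rfl
      exact h3 (trans h1 (symm h2))
    -- Unrelated pairs are disjoint and fill the input set. As `t` is constant on each, its total
    -- would be even.
    have hu : ({α, α', β, β'} : Finset (Fin 2 × Fin 2)) = Finset.univ := by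
      apply Finset.eq_univ_of_card
      rw [Finset.card_insert_of_notMem (by simp [hα', n1, n2]),
        Finset.card_insert_of_notMem (by simp [n3, n4]),
        Finset.card_insert_of_notMem (by simp [hβ'])]
      simp
    have hsum : ∑ γ, t γ = 1 := by
      rw [Fintype.sum_prod_type, ← h.odd]
      simp only [Fin.sum_univ_two, add_assoc]
    rw [← hu, Finset.sum_insert (by simp [hα', n1, n2]), Finset.sum_insert (by simp [n3, n4]),
      Finset.sum_insert (by simp [hβ']), Finset.sum_singleton, h1.1, h2.1] at hsum
    exact (by decide : ∀ x y : Fin 2, x + (x + (y + y)) ≠ 1) _ _ hsum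
  obtain ⟨k, m⟩ := α
  obtain ⟨l, n⟩ := β
  have hf : f k = f l := by
    by_cases hk : k = l
    · rw [hk]
    · exact h3.2.1 hk k l
  have hg : g m = g n := by
    by_cases hm : m = n
    · rw [hm]
    · exact h3.2.2 hm m n
  funext i
  simp only [outVec, hf, hg, h3.1]

end IsPRData

theorem proposition4 (Φ : TwoQubitOp →ₗ[ℂ] TwoQubitOp) (A A' B B' : ChannelMeasurement)
    (hΦ : IsPRChannelWith Φ A A' B B') :
    ∃ a b : QubitBasis,
      (trSnd A.input = ketbra (a 0) (a 0) ∧ trSnd A'.input = ketbra (a 1) (a 1) ∧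
        trSnd B.input = ketbra (b 0) (b 0) ∧ trSnd B'.input = ketbra (b 1) (b 1)) ∧
      ∃ (U : Fin 2 × Fin 2 → Matrix (Fin 2 × Fin 2) (Fin 2) ℂ)
        (Δ₀ Δ₁ : Finset (Fin 2 × Fin 2))
        (Vout : Matrix (Fin 2 × Fin 2) (Fin 2) ℂ)
        (Vin : Matrix (Fin 2 × Fin 2) (Fin Δ₁.card) ℂ)
        (e : Fin Δ₁.card ≃ Δ₁)
        (z : Fin Δ₁.card → ℂ) (x y : Fin Δ₁.card → Fin Δ₁.card → ℂ)
        (w : Fin 2 × Fin 2 → ℂ),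
        (∀ α, IsIsometry (U α)) ∧
        Δ₀ ∪ Δ₁ = Finset.univ ∧ Disjoint Δ₀ Δ₁ ∧
        IsIsometry Vout ∧ (∀ α ∈ Δ₁, U α = Vout) ∧
        IsIsometry Vin ∧ (∀ p, Vin.col p = prodKet a b (e p)) ∧
        (∀ α ∈ Δ₀, ‖w α‖ ≤ 1) ∧
        choi a b Φ =
          (Vout ⊗ₖ Vin) * Bblock Δ₁.card z x y * (Voutᴴ ⊗ₖ Vinᴴ)
          + ∑ α ∈ Δ₀, ((1 / 2 : ℂ) • (U α * Bdiag (w α) * (U α)ᴴ)) ⊗ₖ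
              ketbra (prodKet a b α) (prodKet a b α) := by
  obtain ⟨a₀, b₀, f, g, t, h, hab⟩ := hΦ.exists_isPRData
  obtain ⟨a, ha⟩ := h.onb_a.exists_orthonormalBasis
  obtain ⟨b, hb⟩ := h.onb_b.exists_orthonormalBasis
  have hket : ∀ α, prodKet a b α = IsPRData.inVec a₀ b₀ α := by
    intro α
    rw [IsPRData.inVec, ← ha, ← hb]
    rfl
  refine ⟨a, b, by simpa only [ha, hb] using hab, ?_⟩
  let Δ := IsPRData.coherentInputs Φ a₀ b₀ f g t
  let U := IsPRData.outIsometry f g t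
  let c := IsPRData.coeff Φ a₀ b₀ f g t
  let e : Fin Δ.card ≃ Δ := Δ.equivFin.symm
  -- `U α₀` serves as `Vout`; if `Δ` is empty, any input will do.
  obtain ⟨α₀, hα₀⟩ : ∃ α₀, ∀ α ∈ Δ, U α = U α₀ := by
    rcases Δ.eq_empty_or_nonempty with hΔ | ⟨α₀, hα₀⟩
    · exact ⟨0, by simp [hΔ]⟩
    · refine ⟨α₀, fun α hα => ?_⟩
      simp only [U, IsPRData.outIsometry, h.outVec_eq_of_mem hα hα₀]
  -- The factors `2` in the parameters compensate the prefactor `1 / 2` of the normal form.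
  refine ⟨U, Finset.univ \ Δ, Δ, U α₀, Matrix.of fun i p => IsPRData.inVec a₀ b₀ (e p) i, e,
    fun p => 2 * c (e p) (e p) 0 1, fun p q => 2 * c (e p) (e q) 0 1,
    fun p q => 2 * c (e p) (e q) 1 0, fun α => 2 * c α α 0 1, h.outIsometry_isIsometry,
    by simp, Finset.sdiff_disjoint, h.outIsometry_isIsometry α₀, hα₀, ?_, ?_,
    fun α _ => h.norm_coeff_le α, ?_⟩
  · ext p q
    have := h.star_inVec_dotProduct (e p) (e q)
    simp only [Subtype.coe_inj, e.injective.eq_iff] at this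
    rw [Matrix.one_apply, ← this]
    rfl
  · intro p
    rw [hket]
    rfl
  · let R : Fin 2 × Fin 2 → Fin 2 × Fin 2 → TwoQubitOp := fun α β =>
      Φ (ketbra (IsPRData.inVec a₀ b₀ α) (IsPRData.inVec a₀ b₀ β))
    let S : Fin 2 × Fin 2 → Fin 2 × Fin 2 → Matrix _ _ ℂ := fun α β =>
      R α β ⊗ₖ ketbra (IsPRData.inVec a₀ b₀ α) (IsPRData.inVec a₀ b₀ β)
    have hS : choi a b Φ = ∑ α, ∑ β, S α β := by
      simp only [choi, hket, S, R]
    have hS0 : ∀ α β, α ≠ β → ¬(α ∈ Δ ∧ β ∈ Δ) → S α β = 0 := by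
      intro α β hαβ hmem
      simp only [S, R, h.apply_ketbra_eq_zero hαβ hmem, Matrix.zero_kronecker]
    have hdiag : ∀ α, ((1 / 2 : ℂ) • (U α * Bdiag (2 * c α α 0 1) * (U α)ᴴ)) ⊗ₖ
        ketbra (prodKet a b α) (prodKet a b α) = S α α := by
      intro α
      simp only [S, R, hket, h.apply_ketbra_eq, h.of_coeff_self, U, c, Matrix.mul_smul,
        Matrix.smul_mul]
    have hblock : ∀ p q, (U α₀ * ((1 / 2 : ℂ) • if p = q then Bdiag (2 * c (e p) (e p) 0 1)
        else Boff (2 * c (e p) (e q) 0 1) (2 * c (e p) (e q) 1 0)) * (U α₀)ᴴ) ⊗ₖ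
        ketbra (IsPRData.inVec a₀ b₀ (e p)) (IsPRData.inVec a₀ b₀ (e q)) = S (e p) (e q) := by
      intro p q
      simp only [S, R, h.apply_ketbra_eq]
      congr 1
      change _ = U (e p) * _ * (U (e q))ᴴ
      rw [hα₀ _ (e p).2, hα₀ _ (e q).2]
      congr 2
      split_ifs with hpq
      · rw [← hpq, h.of_coeff_self]
      · rw [h.of_coeff_of_ne fun h1 => hpq (e.injective (Subtype.ext h1))]
    have hsum : ∑ p, ∑ q, S (e p) (e q) = ∑ α ∈ Δ, ∑ β ∈ Δ, S α β := by
      rw [Equiv.sum_comp e fun α : Δ => ∑ q, S α (e q), ← Finset.sum_coe_sort Δ]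
      refine Finset.sum_congr rfl fun α _ => ?_
      rw [Equiv.sum_comp e fun β : Δ => S α β, ← Finset.sum_coe_sort Δ]
    rw [kronecker_mul_Bblock_mul]
    simp only [hdiag]
    rw [hS, ← Finset.sum_sdiff (Finset.subset_univ Δ), add_comm]
    congr 1
    -- For `α ∈ Δ` the blocks with `β ∉ Δ` vanish, which leaves the square block over `Δ`.
    · refine Eq.trans ?_ (hsum.symm.trans
        (Finset.sum_congr rfl fun p _ => Finset.sum_congr rfl fun q _ => (hblock p q).symm))
      refine Finset.sum_congr rfl fun α hα => ?_
      refine (Finset.sum_subset (Finset.subset_univ Δ) fun β _ hβ => ?_).symm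
      exact hS0 α β (fun h1 => hβ (h1 ▸ hα)) fun h1 => hβ h1.2
    · refine Finset.sum_congr rfl fun α hα => ?_
      have hα' : α ∉ Δ := (Finset.mem_sdiff.mp hα).2
      rw [Finset.sum_eq_single α]
      · exact fun β _ hβ => hS0 α β hβ.symm fun h1 => hα' h1.1
      · simp
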